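/- For an integer $k$ let $S_k$ be the complex vector space of cusp forms of weight $k$ for $\mathrm{SL}_2(\mathbb{Z})$. For $m\ge 1$ let $T_m$ be the Hecke operator on $S_k$, $$(T_m f)(z)=m^{k-1}\sum_{\substack{ad=m\\ a,d>0}}\ \sum_{b=0}^{d-1} d^{-k} f\!\left(\frac{az+b}{d}\right).$$ An element of $S_k$ is called a cusp eigenform if it is a simultaneous eigenfunction of all $T_m$, $m\ge 1$. The Hecke algebra over $\mathbb{Q}$ of $S_k$ is the $\mathbb{Q}$-subalgebra of $\mathrm{End}_{\mathbb{C}}(S_k)$ generated by all $T_m$, $m\ge 1$. Maeda's conjecture for $S_k$ is the assertion that the Hecke algebra over $\mathbb{Q}$ of $S_k$ is simple (that is, a single number field), and that its Galois closure over $\mathbb{Q}$ has Galois group isomorphic to the symmetric group $\mathfrak{S}_n$, where $n=\dim_{\mathbb{C}} S_k$. The Petersson inner product of $h,g\in S_{k}$ is $$\langle h,g\rangle=\int_{\mathcal{H}/\mathrm{SL}_2(\mathbb{Z})}\overline{h(z)}\,g(z)\,y^{k-2}\,dx\,dy ,\qquad z=x+iy .$$ **Theorem.** Let $k$ be an integer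 and assume Maeda's conjecture for $S_k$ and for $S_{2k}$. If $f\in S_k$ and $g\in S_{2k}$ are any nonzero cusp eigenforms, then the (weight $2k$) Petersson inner product $\langle f^2,g\rangle$ is nonzero. -/

import Mathlib

open UpperHalfPlane
open scoped MatrixGroups ModularForm Manifold

namespace Maeda

noncomputable section

/-! ### Hecke operators on level one cusp forms -/

/-- An integral `2 × 2` matrix of determinant `m ≠ 0`, viewed in `GL (Fin 2) ℝ`. -/
def toGL {m : ℤ} (hm : m ≠ 0) (A : FixedDetMatrix (Fin 2) ℤ m) : GL (Fin 2) ℝ :=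
  Matrix.GeneralLinearGroup.mkOfDetNeZero (A.1.map (Int.cast : ℤ → ℝ)) (by
    have h : (A.1.map (Int.cast : ℤ → ℝ)).det = (m : ℝ) :=
      (Int.cast_det A.1).symm.trans (congrArg _ A.2)
    rw [h]; exact_mod_cast hm)

/-- The Hecke operator `T_m` on functions: the sum of `f ∣[k] A` over the matrices
`A = (a b; 0 d)` with `a, d > 0`, `a d = m`, `0 ≤ b < d` (this is the set
`FixedDetMatrices.reps m`). Mathlib's slash action of `GL (Fin 2) ℝ` contains the factor
`(det A) ^ (k - 1)`, so explicitly
`(T_m f)(z) = m ^ (k - 1) * ∑_{a d = m} ∑_{0 ≤ b < d} d ^ (-k) * f ((a z + b) / d)`. -/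
def heckeFun (k : ℤ) (m : ℕ+) (f : ℍ → ℂ) : ℍ → ℂ :=
  ∑ A : FixedDetMatrices.reps ((m : ℕ) : ℤ), f ∣[k] toGL (by exact_mod_cast m.ne_zero) A.1

section Invariance

variable {m : ℤ}

lemma toGL_apply (hm : m ≠ 0) (A : FixedDetMatrix (Fin 2) ℤ m) (i j : Fin 2) :
    toGL hm A i j = (A.1 i j : ℝ) := rfl

lemma det_toGL (hm : m ≠ 0) (A : FixedDetMatrix (Fin 2) ℤ m) :
    (toGL hm A).det.val = (m : ℝ) :=
  (Int.cast_det A.1).symm.trans (congrArg _ A.2)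

/-- Right multiplication of an integral matrix of determinant `m` by an element of `SL(2, ℤ)`. -/
def mulRight (A : FixedDetMatrix (Fin 2) ℤ m) (γ : SL(2, ℤ)) : FixedDetMatrix (Fin 2) ℤ m :=
  ⟨A.1 * γ.1, by rw [Matrix.det_mul, A.2, γ.2, mul_one]⟩

lemma toGL_mulRight (hm : m ≠ 0) (A : FixedDetMatrix (Fin 2) ℤ m) (γ : SL(2, ℤ)) :
    toGL hm (mulRight A γ) = toGL hm A * (γ : GL (Fin 2) ℝ) := by
  ext i j
  change (((A.1 * γ.1) i j : ℤ) : ℝ) = _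
  simp [toGL_apply, Matrix.mul_apply]

lemma toGL_smul (hm : m ≠ 0) (A : FixedDetMatrix (Fin 2) ℤ m) (γ : SL(2, ℤ)) :
    toGL hm (γ • A) = (γ : GL (Fin 2) ℝ) * toGL hm A := by
  ext i j
  simp [toGL_apply, FixedDetMatrices.smul_coe, Matrix.mul_apply]

lemma exists_reps (hm : m ≠ 0) (A : FixedDetMatrix (Fin 2) ℤ m) :
    ∃ (R : FixedDetMatrices.reps m) (δ : SL(2, ℤ)), A = δ • R.1 := by
  induction A using FixedDetMatrices.induction_on hm with
  | h0 A h1 h2 h3 h4 => exact ⟨⟨A, h1, h2, h3, h4⟩, 1, (one_smul _ _).symm⟩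
  | hS B hB =>
    obtain ⟨R, δ, h⟩ := hB
    exact ⟨R, ModularGroup.S * δ, by rw [mul_smul, ← h]⟩
  | hT B hB =>
    obtain ⟨R, δ, h⟩ := hB
    exact ⟨R, ModularGroup.T * δ, by rw [mul_smul, ← h]⟩

lemma reps_unique (hm : 0 < m) {A B : FixedDetMatrix (Fin 2) ℤ m}
    (hA : A ∈ FixedDetMatrices.reps m) (hB : B ∈ FixedDetMatrices.reps m) (δ : SL(2, ℤ))
    (h : A = δ • B) : A = B := by
  obtain ⟨a1, a2, a3, a4⟩ := hA
  obtain ⟨b1, b2, b3, b4⟩ := hB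
  have hAd := A.2
  have hBd := B.2
  have hδ := δ.2
  rw [Matrix.det_fin_two] at hAd hBd hδ
  have e : ∀ i j, A.1 i j = δ.1 i 0 * B.1 0 j + δ.1 i 1 * B.1 1 j := fun i j ↦ by
    rw [h, FixedDetMatrices.smul_coe, Matrix.mul_apply, Fin.sum_univ_two]
  have e00 := e 0 0
  have e01 := e 0 1
  have e10 := e 1 0
  have e11 := e 1 1
  rw [b1, mul_zero, add_zero] at e00 e10
  rw [a1] at e10
  have d10 : δ.1 1 0 = 0 := by
    rcases mul_eq_zero.mp e10.symm with h | h
    · exact h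
    · exact absurd h b2.ne'
  rw [d10, mul_zero, sub_zero] at hδ
  have d00 : 0 < δ.1 0 0 := by
    by_contra hn
    nlinarith
  have d00' : δ.1 0 0 = 1 := Int.eq_one_of_mul_eq_one_right d00.le hδ
  have d11 : δ.1 1 1 = 1 := by rwa [d00', one_mul] at hδ
  rw [d10, d11, zero_mul, zero_add, one_mul] at e11
  rw [d00', one_mul] at e00 e01
  have hd : 0 < B.1 1 1 := by
    rw [b1, mul_zero, sub_zero] at hBd
    by_contra hn
    nlinarith
  rw [e11, abs_of_nonneg a3, abs_of_pos hd] at a4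
  rw [abs_of_nonneg b3, abs_of_pos hd] at b4
  have d01 : δ.1 0 1 = 0 := by
    by_contra hn
    rcases lt_or_gt_of_ne hn with h' | h'
    · nlinarith
    · nlinarith
  rw [d01, zero_mul, add_zero] at e01
  ext i j
  fin_cases i <;> fin_cases j
  · exact e00
  · exact e01
  · exact a1.trans b1.symm
  · exact e11

/-- The representative of the orbit of `A * γ`. -/
def permRep (hm : m ≠ 0) (γ : SL(2, ℤ)) (A : FixedDetMatrices.reps m) :
    FixedDetMatrices.reps m :=
  (exists_reps hm (mulRight A.1 γ)).choose

lemma permRep_spec (hm : m ≠ 0) (γ : SL(2, ℤ)) (A : FixedDetMatrices.reps m) :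
    ∃ δ : SL(2, ℤ), mulRight A.1 γ = δ • (permRep hm γ A).1 :=
  (exists_reps hm (mulRight A.1 γ)).choose_spec

lemma permRep_bijective (hm : 0 < m) (γ : SL(2, ℤ)) :
    Function.Bijective (permRep hm.ne' γ) := by
  refine Finite.injective_iff_bijective.mp fun A B h ↦ ?_
  obtain ⟨δ, hδ⟩ := permRep_spec hm.ne' γ A
  obtain ⟨ε, hε⟩ := permRep_spec hm.ne' γ B
  rw [← h] at hε
  have h1 : mulRight A.1 γ = (δ * ε⁻¹) • mulRight B.1 γ := by
    rw [hε, hδ, mul_smul, inv_smul_smul]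
  have h2 : A.1 = (δ * ε⁻¹) • B.1 := by
    have h3 := congrArg (fun C ↦ mulRight C γ⁻¹) h1
    have h4 : γ.1 * (γ⁻¹).1 = 1 := by
      have := congrArg Subtype.val (mul_inv_cancel γ)
      exact this
    apply FixedDetMatrices.ext'
    have h5 := congrArg Subtype.val h3
    change A.1.1 * γ.1 * (γ⁻¹).1 = (δ * ε⁻¹).1 * (B.1.1 * γ.1) * (γ⁻¹).1 at h5
    simp only [Matrix.mul_assoc, h4, Matrix.mul_one] at h5
    exact h5
  exact Subtype.ext (reps_unique hm A.2 B.2 _ h2)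

end Invariance

lemma heckeFun_slash (k : ℤ) (m : ℕ+) (f : ℍ → ℂ) (hf : ∀ γ : SL(2, ℤ), f ∣[k] γ = f)
    (γ : SL(2, ℤ)) : heckeFun k m f ∣[k] γ = heckeFun k m f := by
  have hm : (0 : ℤ) < ((m : ℕ) : ℤ) := by exact_mod_cast m.pos
  rw [heckeFun, SlashAction.sum_slash]
  refine Fintype.sum_bijective (permRep hm.ne' γ) (permRep_bijective hm γ) _ _ fun A ↦ ?_
  obtain ⟨δ, hδ⟩ := permRep_spec hm.ne' γ A
  rw [ModularForm.SL_slash, ← SlashAction.slash_mul, ← toGL_mulRight, hδ, toGL_smul,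
    SlashAction.slash_mul, ← ModularForm.SL_slash, hf]

/-- The Hecke operator `T_m` as an endomorphism of the space `S_k` of cusp forms of weight `k`
for `SL(2, ℤ)`. -/
def heckeOperator (k : ℤ) (m : ℕ+) : Module.End ℂ (CuspForm 𝒮ℒ k) where
  toFun f :=
    { toFun := heckeFun k m f
      slash_action_eq' := by
        rintro _ ⟨γ, rfl⟩
        exact heckeFun_slash k m f (fun δ ↦ f.slash_action_eq' _ ⟨δ, rfl⟩) γ
      holo' := .sum fun A _ ↦ (CuspFormClass.holo f).slash k _
      zero_at_cusps' := by
        intro c hc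
        rw [OnePoint.isZeroAt_iff_forall_SL2Z hc]
        intro γ _
        have h := heckeFun_slash k m f (fun δ ↦ f.slash_action_eq' _ ⟨δ, rfl⟩) γ
        change IsZeroAtImInfty (heckeFun k m f ∣[k] γ)
        rw [h, heckeFun, IsZeroAtImInfty, Filter.ZeroAtFilter, Finset.sum_fn]
        rw [show (0 : ℂ) = ∑ A : FixedDetMatrices.reps ((m : ℕ) : ℤ), 0 by simp]
        refine tendsto_finsetSum _ fun A _ ↦ ?_
        refine IsZeroAtImInfty.slash k ?_ (CuspFormClass.zero_at_infty f)
        rw [toGL_apply, A.2.1, Int.cast_zero] }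
  map_add' f g := by
    ext z
    change heckeFun k m (f + g) z = heckeFun k m f z + heckeFun k m g z
    simp [heckeFun, Finset.sum_add_distrib]
  map_smul' c f := by
    ext z
    change heckeFun k m (c • ⇑f) z = c * heckeFun k m f z
    have hm : (0 : ℝ) < ((m : ℕ) : ℤ) := by exact_mod_cast m.pos
    simp [heckeFun, ModularForm.smul_slash, UpperHalfPlane.σ, det_toGL, Finset.mul_sum,
      -Matrix.GeneralLinearGroup.val_det_apply]

/-- `f ∈ S_k` is a simultaneous eigenfunction of all Hecke operators `T_m`, `m ≥ 1`. -/
def IsHeckeEigenform {k : ℤ} (f : CuspForm 𝒮ℒ k) : Prop :=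
  ∀ m : ℕ+, ∃ a : ℂ, heckeOperator k m f = a • f

/-! ### Maeda's conjecture -/

instance instAlgebraRatEnd (k : ℤ) : Algebra ℚ (Module.End ℂ (CuspForm 𝒮ℒ k)) :=
  Algebra.compHom _ (algebraMap ℚ ℂ)

/-- The Hecke algebra over `ℚ` of `S_k`: the `ℚ`-subalgebra of `End_ℂ(S_k)` generated by all
Hecke operators `T_m`, `m ≥ 1`. -/
def heckeAlgebra (k : ℤ) : Subalgebra ℚ (Module.End ℂ (CuspForm 𝒮ℒ k)) :=
  Algebra.adjoin ℚ (Set.range (heckeOperator k))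

/-- Maeda's conjecture for `S_k`: the Hecke algebra over `ℚ` of `S_k` is (isomorphic to) a single
number field `K`, and the Galois closure of `K` over `ℚ` (formed inside `ℂ`: the compositum of the
images of all embeddings of `K`) has Galois group over `ℚ` isomorphic to the symmetric group on
`n` letters, where `n = dim S_k`. -/
def MaedaConjecture (k : ℤ) : Prop :=
  ∃ (K : Type) (_ : Field K) (_ : NumberField K),
    Nonempty (heckeAlgebra k ≃ₐ[ℚ] K) ∧
    Nonempty ((IntermediateField.normalClosure ℚ K ℂ ≃ₐ[ℚ] IntermediateField.normalClosure ℚ K ℂ) ≃*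
      Equiv.Perm (Fin (Module.finrank ℂ (CuspForm 𝒮ℒ k))))

/-! ### The Petersson inner product -/

/-- The weight `k` Petersson inner product
`⟨f, g⟩ = ∫ conj (f z) * g z * y ^ (k - 2) dx dy` over the standard fundamental domain of
`SL(2, ℤ)` in the upper half plane. Here `petersson k f g z = conj (f z) * g z * y ^ k`, and
Mathlib's volume on `ℍ` is the invariant measure `dx dy / y ^ 2`. -/
def peterssonInner (k : ℤ) (f g : ℍ → ℂ) : ℂ :=
  ∫ z in ModularGroup.fd, petersson k f g z

end

end Maeda

namespace Maeda

noncomputable section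

/-! ### A transitivity criterion for simultaneous actions on two finite sets -/

/-! The automorphisms of `ℂ` act on normalized eigenforms by conjugating Fourier coefficients. This
makes sense because level one `q`-expansions are stable under conjugation
(`exists_modularForm_qExpansion_map`) and the Hecke operators act on them by rational formulas
(`coeff_heckeOperator`). Under Maeda's conjecture there are as many normalized eigenforms as the
dimension of the space, and every permutation of them is realized
(`MaedaConjecture.toPermHom_surjective`).

Scale `f` and `g` to be normalized and write `f² = ∑ c_j g_j` over the normalized eigenforms `g_j`
of weight `2k`. An automorphism `σ` fixing `f` fixes `f²`, so `c_{σ j} = σ (c_j)`. It therefore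
suffices that such `σ` move `g` to every `g_j`: then `c_g = 0` would force `f² = 0`. Eigenforms are
orthogonal (`peterssonInner_heckeOperator_comm`), so the inner product is a nonzero multiple of the
conjugate of `c_g`.

Transitivity comes from group theory (`exists_smul_eq_of_smul_eq_self`). The automorphisms fixing
all eigenforms of weight `k` form a normal subgroup, whose image in the symmetric group on the `g_j`
is normal. It is nontrivial when there are more eigenforms in weight `2k` than in weight `k`
(`finrank_lt_of_ne`), and a nontrivial normal subgroup of a symmetric group is transitive. A single
eigenform in weight `2k` is a trivial case. -/

/-- If a group acts on finite sets `X` and `Y`, inducing all permutations of `Y`, and `Y` is larger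
than `X`, then the elements acting trivially on `X` already act transitively on `Y`. -/
lemma exists_smul_eq_of_smul_eq_self {G X Y : Type*} [Group G] [MulAction G X] [MulAction G Y]
    [Finite X] [Finite Y] (hY : Function.Surjective (MulAction.toPermHom G Y))
    (hXY : (Nat.card X).factorial < (Nat.card Y).factorial ∨ Subsingleton Y) (y y' : Y) :
    ∃ σ : G, (∀ x : X, σ • x = x) ∧ σ • y = y' := by
  rcases hXY with hXY | hs
  swap
  · exact ⟨1, fun x ↦ one_smul _ x, Subsingleton.elim _ _⟩
  set H : Subgroup G := (MulAction.toPermHom G X).ker with hH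
  let N : Subgroup (Equiv.Perm Y) := H.map (MulAction.toPermHom G Y)
  have hN : N.Normal := Subgroup.Normal.map inferInstance _ hY
  -- If `N` were trivial, the kernel on `X` would lie in the kernel on `Y`; comparing indices gives
  -- `|Y|! ≤ |X|!`.
  have key : MulAction.fixedPoints N Y ≠ .univ := by
    intro hfix
    have hle : H ≤ (MulAction.toPermHom G Y).ker := by
      intro σ hσ
      rw [MonoidHom.mem_ker]
      ext z
      have hz : z ∈ MulAction.fixedPoints N Y := hfix ▸ Set.mem_univ z
      exact hz ⟨MulAction.toPermHom G Y σ, Subgroup.mem_map_of_mem _ hσ⟩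
    have hfin : H.index ≠ 0 := by
      rw [hH, Subgroup.index_ker]
      exact Nat.card_pos.ne'
    have h1 : (MulAction.toPermHom G Y).ker.index ≤ H.index :=
      Nat.le_of_dvd (Nat.pos_of_ne_zero hfin) (Subgroup.index_dvd_of_le hle)
    have h2 : H.index ≤ (Nat.card X).factorial := by
      rw [hH, Subgroup.index_ker, ← Nat.card_perm]
      exact Subgroup.card_le_card_group _
    have h3 : (MulAction.toPermHom G Y).ker.index = (Nat.card Y).factorial := by
      rw [Subgroup.index_ker, ← Nat.card_perm, MonoidHom.range_eq_top.mpr hY, Subgroup.card_top]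
    omega
  -- The full symmetric group acts primitively, so its normal subgroups act trivially or
  -- transitively.
  have : MulAction.IsPretransitive N Y :=
    MulAction.IsQuasiPreprimitive.isPretransitive_of_normal key
  obtain ⟨⟨π, hπ⟩, h⟩ := MulAction.exists_smul_eq N y y'
  obtain ⟨σ, hσ, rfl⟩ := hπ
  refine ⟨σ, fun x ↦ ?_, h⟩
  exact DFunLike.congr_fun (MonoidHom.mem_ker.mp hσ) x

/-! ### Extending field embeddings to automorphisms of an algebraically closed field -/

/-- Two algebraically closed extensions with transcendence bases indexed by the same set are
isomorphic as extensions. -/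
lemma exists_ringEquiv_of_isTranscendenceBasis {F C D ι : Type*} [Field F] [Field C] [Field D]
    [Algebra F C] [Algebra F D] [IsAlgClosed C] [IsAlgClosed D] {v : ι → C} {w : ι → D}
    (hv : IsTranscendenceBasis F v) (hw : IsTranscendenceBasis F w) :
    ∃ σ : C ≃+* D, ∀ x : F, σ (algebraMap F C x) = algebraMap F D x := by
  let := IsAlgClosed.isAlgClosure_of_transcendence_basis v hv
  let := IsAlgClosed.isAlgClosure_of_transcendence_basis w hw
  let e : Algebra.adjoin F (Set.range v) ≃ₐ[F] Algebra.adjoin F (Set.range w) :=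
    hv.1.aevalEquiv.symm.trans hw.1.aevalEquiv
  refine ⟨IsAlgClosure.equivOfEquiv C D e.toRingEquiv, fun x ↦ ?_⟩
  have h := IsAlgClosure.equivOfEquiv_algebraMap C D e.toRingEquiv
    (algebraMap F (Algebra.adjoin F (Set.range v)) x)
  rw [← IsScalarTower.algebraMap_apply] at h
  rw [h]
  change algebraMap _ D (e (algebraMap F _ x)) = _
  rw [e.commutes, ← IsScalarTower.algebraMap_apply]

/-- Any two embeddings of an algebraic extension of `ℚ` into an algebraically closed field are
conjugate under an automorphism. -/
lemma exists_ringEquiv_comp_eq {F C : Type*} [Field F] [Algebra ℚ F] [Algebra.IsAlgebraic ℚ F]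
    [Field C] [CharZero C] [IsAlgClosed C] (i j : F →+* C) :
    ∃ σ : C ≃+* C, ∀ x, σ (i x) = j x := by
  obtain ⟨s, hs⟩ := exists_isTranscendenceBasis ℚ C
  -- As `F` is algebraic over `ℚ`, the same `s` is a transcendence basis over `F` for either
  -- embedding, so the two structures on `C` have bases with a common index set.
  have h : ∀ i : F →+* C, letI := i.toAlgebra
      IsTranscendenceBasis F (Subtype.val : s → C) := by
    intro i
    let := i.toAlgebra
    have : IsScalarTower ℚ F C := .of_algebraMap_eq fun q ↦ by simp
    exact (Algebra.IsAlgebraic.isTranscendenceBasis_iff ℚ F).mp hs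
  exact @exists_ringEquiv_of_isTranscendenceBasis F C C s _ _ _ i.toAlgebra j.toAlgebra _ _
    Subtype.val Subtype.val (h i) (h j)

/-! ### Conjugating `q`-expansions by automorphisms of `ℂ` -/

lemma cuspForm_ext_qExpansion {k : ℤ} {f g : CuspForm 𝒮ℒ k}
    (h : qExpansion 1 f = qExpansion 1 g) : f = g := by
  have h1 : qExpansion 1 (f - g : CuspForm 𝒮ℒ k) = 0 := by
    rw [FunLike.coe_sub, ModularForm.qExpansion_sub one_pos one_mem_strictPeriods_SL, h, sub_self]
  have h2 := (ModularForm.qExpansion_eq_zero_iff one_pos one_mem_strictPeriods_SL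
    ((f - g : CuspForm 𝒮ℒ k) : ModularForm 𝒮ℒ k)).mp h1
  have h3 : f - g = 0 := CuspForm.ext fun z ↦ DFunLike.congr_fun h2 z
  exact sub_eq_zero.mp h3

/-- The coefficients of the normalized Eisenstein series are rational, by the Bernoulli number
formula. -/
lemma qExpansion_eisenstein_map (σ : ℂ →+* ℂ) {k : ℕ} (hk : 3 ≤ k) (hk2 : Even k) :
    (qExpansion 1 (ModularForm.E hk)).map σ = qExpansion 1 (ModularForm.E hk) := by
  ext m
  rw [PowerSeries.coeff_map, EisensteinSeries.E_qExpansion_coeff hk hk2]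
  split_ifs
  · exact map_one σ
  · have h2 : σ 2 = 2 := map_ofNat σ 2
    simp [h2]

open ModularForm EisensteinSeries in
lemma qExpansion_discriminant_eq : qExpansion 1 discriminant =
    PowerSeries.C (1728⁻¹ : ℂ) * (qExpansion 1 E₄ ^ 3 - qExpansion 1 E₆ ^ 2) := by
  have h : (discriminant : ℍ → ℂ) = (1728⁻¹ : ℂ) • (⇑(E₄.pow 3) - ⇑(E₆.pow 2)) := by
    ext z
    simp [discriminant_eq_E₄_cube_sub_E₆_sq, div_eq_inv_mul]
    rfl
  have h4 := ModularFormClass.analyticAt_cuspFunction_zero (E₄.pow 3) one_pos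
    one_mem_strictPeriods_SL
  have h6 := ModularFormClass.analyticAt_cuspFunction_zero (E₆.pow 2) one_pos
    one_mem_strictPeriods_SL
  have h46 : AnalyticAt ℂ (cuspFunction 1 (⇑(E₄.pow 3) - ⇑(E₆.pow 2))) 0 := by
    rw [cuspFunction_sub h4.continuousAt h6.continuousAt]
    exact h4.sub h6
  rw [h, qExpansion_smul h46, qExpansion_sub h4 h6,
    ModularForm.qExpansion_pow one_pos one_mem_strictPeriods_SL,
    ModularForm.qExpansion_pow one_pos one_mem_strictPeriods_SL, PowerSeries.smul_eq_C_mul]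

lemma qExpansion_discriminant_map (σ : ℂ →+* ℂ) :
    (qExpansion 1 ModularForm.discriminant).map σ = qExpansion 1 ModularForm.discriminant := by
  have h4 := qExpansion_eisenstein_map σ (k := 4) (by norm_num) ⟨2, rfl⟩
  have h6 := qExpansion_eisenstein_map σ (k := 6) (by norm_num) ⟨3, rfl⟩
  rw [qExpansion_discriminant_eq, map_mul, map_sub, map_pow, map_pow, PowerSeries.map_C, h4, h6,
    map_inv₀]
  congr 3
  exact map_ofNat σ 1728

/-- Every cusp form is `Δ` times a modular form of weight `k - 12`, and `Δ` has rational
coefficients. The weight `k - 12` case is a hypothesis so that the lemma serves inside the induction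
below as well as after it. -/
lemma exists_qExpansion_ofMulDiscriminant_map (σ : ℂ →+* ℂ) {k : ℤ}
    (ih : ∀ f : ModularForm 𝒮ℒ (k - 12), ∃ f' : ModularForm 𝒮ℒ (k - 12),
      qExpansion 1 f' = (qExpansion 1 f).map σ) (f : CuspForm 𝒮ℒ k) :
    ∃ f' : CuspForm 𝒮ℒ k, qExpansion 1 f' = (qExpansion 1 f).map σ := by
  obtain ⟨g, hg⟩ := ih (CuspForm.discriminantEquiv f)
  refine ⟨CuspForm.ofMulDiscriminant g, ?_⟩
  have h : ∀ g : ModularForm 𝒮ℒ (k - 12), qExpansion 1 (CuspForm.ofMulDiscriminant g) =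
      qExpansion 1 ModularForm.discriminant * qExpansion 1 g := fun g ↦
    ModularForm.qExpansion_mul_coe one_pos one_mem_strictPeriods_SL CuspForm.discriminant g
  have hf : f = CuspForm.ofMulDiscriminant (CuspForm.discriminantEquiv f) := by
    ext z
    simp
  rw [h, hg]
  conv_rhs => rw [hf, h, map_mul, qExpansion_discriminant_map]

/-- The `q`-expansions of level one modular forms are stable under conjugation. -/
lemma exists_modularForm_qExpansion_map (σ : ℂ →+* ℂ) (k : ℤ) (f : ModularForm 𝒮ℒ k) :
    ∃ f' : ModularForm 𝒮ℒ k, qExpansion 1 f' = (qExpansion 1 f).map σ := by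
  -- Weights `k ≤ 0` all have `k.toNat = 0` and are settled directly.
  induction hn : k.toNat using Nat.strong_induction_on generalizing k with
  | _ n ih =>
  by_cases hf : f = 0
  · subst hf
    exact ⟨0, by simp [qExpansion_zero]⟩
  rcases lt_trichotomy k 0 with hk | rfl | hk
  · exact absurd (rank_zero_iff_forall_zero.mp (ModularForm.levelOne_neg_weight_rank_zero hk) f) hf
  · obtain ⟨c, hc⟩ := ModularFormClass.levelOne_weight_zero_const f
    have h : ∀ c : ℂ, qExpansion 1 (ModularForm.const c : ModularForm 𝒮ℒ 0) = PowerSeries.C c := by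
      intro c
      have : (ModularForm.const c : ModularForm 𝒮ℒ 0) = c • (1 : ModularForm 𝒮ℒ 0) := by
        ext z; simp
      rw [this, FunLike.coe_smul, ModularForm.qExpansion_smul one_pos one_mem_strictPeriods_SL,
        ModularForm.qExpansion_one, PowerSeries.smul_eq_C_mul, mul_one]
    have hf' : f = ModularForm.const c := by
      ext z; rw [hc]; rfl
    exact ⟨ModularForm.const (σ c), by rw [hf', h, h, PowerSeries.map_C]⟩
  · lift k to ℕ using hk.le
    rcases Nat.even_or_odd k with hk2 | hk2
    swap
    · exact absurd (ModularForm.levelOne_odd_weight_eq_zero (by exact_mod_cast hk2) f) hf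
    have h3 : 3 ≤ k := by
      by_contra h
      obtain rfl : k = 2 := by
        obtain ⟨r, rfl⟩ := hk2
        omega
      exact hf (rank_zero_iff_forall_zero.mp ModularForm.levelOne_weight_two_rank_zero f)
    set a := (qExpansion 1 f).coeff 0
    -- The Eisenstein series has constant term `1`, so `f - a E_k` is a cusp form, and dividing by
    -- `Δ` lowers the weight by `12`.
    obtain ⟨g, hg⟩ := ModularForm.sub_smul_isCuspForm f (ModularForm.E h3)
      (EisensteinSeries.E_qExpansion_coeff_zero h3 hk2)
    obtain ⟨g', hg'⟩ := exists_qExpansion_ofMulDiscriminant_map σ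
      (fun f ↦ ih _ (by omega) _ f rfl) g
    refine ⟨(g' : ModularForm 𝒮ℒ k) + σ a • ModularForm.E h3, ?_⟩
    have hfg : f = (g : ModularForm 𝒮ℒ k) + a • ModularForm.E h3 := by
      rw [← CuspForm.toModularFormₗ_eq_coe, hg, sub_add_cancel]
    have hsum : ∀ (h : CuspForm 𝒮ℒ k) (c : ℂ),
        qExpansion 1 ((h : ModularForm 𝒮ℒ k) + c • ModularForm.E h3 : ModularForm 𝒮ℒ k) =
        qExpansion 1 h + PowerSeries.C c * qExpansion 1 (ModularForm.E h3) := by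
      intro h c
      rw [FunLike.coe_add, ModularForm.qExpansion_add one_pos one_mem_strictPeriods_SL,
        FunLike.coe_smul, ModularForm.qExpansion_smul one_pos one_mem_strictPeriods_SL,
        PowerSeries.smul_eq_C_mul]
      rfl
    conv_rhs => rw [hfg]
    rw [hsum, hsum, map_add, map_mul, PowerSeries.map_C, qExpansion_eisenstein_map σ h3 hk2, hg']

/-- The `q`-expansions of level one cusp forms are stable under conjugation. -/
lemma exists_cuspForm_qExpansion_map (σ : ℂ →+* ℂ) {k : ℤ} (f : CuspForm 𝒮ℒ k) :
    ∃ f' : CuspForm 𝒮ℒ k, qExpansion 1 f' = (qExpansion 1 f).map σ :=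
  exists_qExpansion_ofMulDiscriminant_map σ (exists_modularForm_qExpansion_map σ _) f

/-! ### Hecke operators on `q`-expansions -/

lemma sum_reps {β : Type*} [AddCommMonoid β] (m : ℕ+) (F : ℤ → ℤ → ℤ → β) :
    ∑ A : FixedDetMatrices.reps ((m : ℕ) : ℤ), F (A.1.1 0 0) (A.1.1 0 1) (A.1.1 1 1) =
      ∑ x ∈ (m : ℕ).divisorsAntidiagonal, ∑ b ∈ Finset.range x.2, F x.1 b x.2 := by
  have hdet : ∀ A : FixedDetMatrices.reps ((m : ℕ) : ℤ),
      A.1.1 0 0 * A.1.1 1 1 = (m : ℕ) ∧ 0 < A.1.1 0 0 ∧ 0 < A.1.1 1 1 ∧ 0 ≤ A.1.1 0 1 ∧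
        A.1.1 0 1 < A.1.1 1 1 := by
    rintro ⟨A, h1, h2, h3, h4⟩
    have h := A.2
    rw [Matrix.det_fin_two, h1, mul_zero, sub_zero] at h
    have hm : (0 : ℤ) < (m : ℕ) := by exact_mod_cast m.pos
    have hd : 0 < A.1 1 1 := by
      by_contra hn
      nlinarith
    rw [abs_of_nonneg h3, abs_of_pos hd] at h4
    exact ⟨h, h2, hd, h3, h4⟩
  rw [Finset.sum_sigma']
  refine Finset.sum_bij (fun A _ ↦ ⟨((A.1.1 0 0).toNat, (A.1.1 1 1).toNat), (A.1.1 0 1).toNat⟩)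
    (fun A _ ↦ ?_) (fun A _ B _ h ↦ ?_) (fun x hx ↦ ?_) fun A _ ↦ ?_
  · obtain ⟨h1, h2, h3, h4, h5⟩ := hdet A
    simp only [Finset.mem_sigma, Nat.mem_divisorsAntidiagonal, Finset.mem_range]
    refine ⟨⟨?_, m.ne_zero⟩, by omega⟩
    rw [← Int.toNat_mul h2.le h3.le, h1, Int.toNat_natCast]
  · obtain ⟨-, h2, h3, h4, -⟩ := hdet A
    obtain ⟨-, h2', h3', h4', -⟩ := hdet B
    simp only [Sigma.mk.injEq, Prod.mk.injEq, heq_eq_eq] at h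
    apply Subtype.ext
    ext i j
    fin_cases i <;> fin_cases j
    · change A.1.1 0 0 = B.1.1 0 0
      omega
    · change A.1.1 0 1 = B.1.1 0 1
      omega
    · exact A.2.1.trans B.2.1.symm
    · change A.1.1 1 1 = B.1.1 1 1
      omega
  · obtain ⟨⟨a, d⟩, b⟩ := x
    simp only [Finset.mem_sigma, Nat.mem_divisorsAntidiagonal, Finset.mem_range] at hx
    obtain ⟨⟨had, hm⟩, hb⟩ := hx
    have ha : 0 < a := Nat.pos_of_ne_zero (by rintro rfl; simp at had; omega)
    refine ⟨⟨⟨!![(a : ℤ), b; 0, d], ?_⟩, ?_⟩, Finset.mem_univ _, ?_⟩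
    · rw [Matrix.det_fin_two_of, ← had]
      push_cast
      ring
    · refine ⟨by simp, by simpa using ha, by simp, ?_⟩
      simpa using hb
    · simp
  · obtain ⟨h1, h2, h3, h4, h5⟩ := hdet A
    simp only [Int.toNat_of_nonneg h2.le, Int.toNat_of_nonneg h3.le, Int.toNat_of_nonneg h4]

lemma slash_toGL_apply (k : ℤ) (m : ℕ+) (f : ℍ → ℂ) (hm : ((m : ℕ) : ℤ) ≠ 0)
    (A : FixedDetMatrices.reps ((m : ℕ) : ℤ)) (z : ℍ) :
    (f ∣[k] toGL hm A.1) z = (m : ℂ) ^ (k - 1) * ((A.1.1 1 1 : ℤ) : ℂ) ^ (-k) *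
      f (ofComplex ((((A.1.1 0 0 : ℤ) : ℂ) * z + ((A.1.1 0 1 : ℤ) : ℂ)) /
        ((A.1.1 1 1 : ℤ) : ℂ))) := by
  have hpos : (0 : ℝ) < (toGL hm A.1).det.val := by
    rw [det_toGL]
    exact_mod_cast m.pos
  have hsmul : toGL hm A.1 • z =
      ofComplex ((((A.1.1 0 0 : ℤ) : ℂ) * z + ((A.1.1 0 1 : ℤ) : ℂ)) / ((A.1.1 1 1 : ℤ) : ℂ)) := by
    rw [← ofComplex_apply (toGL hm A.1 • z), coe_smul_of_det_pos hpos]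
    simp [num, denom, toGL_apply, A.2.1]
  rw [ModularForm.slash_apply, hsmul]
  simp only [σ, det_toGL, denom, toGL_apply, A.2.1]
  simp
  ring

lemma heckeFun_apply (k : ℤ) (m : ℕ+) (f : ℍ → ℂ) (z : ℍ) :
    heckeFun k m f z = ∑ x ∈ (m : ℕ).divisorsAntidiagonal, ∑ b ∈ Finset.range x.2,
      (m : ℂ) ^ (k - 1) * (x.2 : ℂ) ^ (-k) *
        f (ofComplex (((x.1 : ℂ) * z + (b : ℂ)) / (x.2 : ℂ))) := by
  rw [heckeFun, Finset.sum_apply]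
  simp_rw [slash_toGL_apply]
  rw [sum_reps m fun a b d ↦ (m : ℂ) ^ (k - 1) * (d : ℂ) ^ (-k) *
        f (ofComplex (((a : ℂ) * z + (b : ℂ)) / (d : ℂ)))]
  simp

/-- Orthogonality of roots of unity: averaging over the translations `b` keeps only the exponents
divisible by `d`. -/
lemma sum_range_exp (d n : ℕ) (hd : d ≠ 0) :
    ∑ b ∈ Finset.range d, Complex.exp (2 * Real.pi * Complex.I / d) ^ (n * b) =
      if d ∣ n then (d : ℂ) else 0 := by
  have hζ := Complex.isPrimitiveRoot_exp d hd
  set ζ := Complex.exp (2 * Real.pi * Complex.I / d)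
  simp_rw [pow_mul]
  split_ifs with h
  · rw [(hζ.pow_eq_one_iff_dvd n).mpr h]
    simp
  · have h1 : ζ ^ n ≠ 1 := fun h' ↦ h ((hζ.pow_eq_one_iff_dvd n).mp h')
    have h2 := geom_sum_mul (ζ ^ n) d
    rw [← pow_mul, mul_comm n d, pow_mul, hζ.pow_eq_one, one_pow, sub_self] at h2
    exact (mul_eq_zero.mp h2).resolve_right (sub_ne_zero.mpr h1)

/-- The `n`-th Fourier coefficient of `T_m f`. -/
lemma coeff_heckeOperator (k : ℤ) (m : ℕ+) (f : CuspForm 𝒮ℒ k) (n : ℕ) :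
    (qExpansion 1 (heckeOperator k m f)).coeff n =
      ∑ x ∈ (m : ℕ).divisorsAntidiagonal, if x.1 ∣ n then
        (m : ℂ) ^ (k - 1) * (x.2 : ℂ) ^ (1 - k) * (qExpansion 1 f).coeff (x.2 * (n / x.1))
      else 0 := by
  refine (ModularFormClass.qExpansion_coeff_unique (c := fun n ↦
    ∑ x ∈ (m : ℕ).divisorsAntidiagonal, if x.1 ∣ n then
        (m : ℂ) ^ (k - 1) * (x.2 : ℂ) ^ (1 - k) * (qExpansion 1 f).coeff (x.2 * (n / x.1))
      else 0) one_pos one_mem_strictPeriods_SL (fun z ↦ ?_) n).symm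
  change HasSum _ (heckeFun k m f z)
  rw [heckeFun_apply]
  simp_rw [Finset.sum_smul]
  refine hasSum_sum fun x hx ↦ ?_
  obtain ⟨a, d⟩ := x
  obtain ⟨had, hm⟩ := Nat.mem_divisorsAntidiagonal.mp hx
  dsimp only at had ⊢
  have ha : a ≠ 0 := by rintro rfl; simp at had; omega
  have hd : d ≠ 0 := by rintro rfl; simp at had; omega
  have hdC : (d : ℂ) ≠ 0 := Nat.cast_ne_zero.mpr hd
  set c := fun n ↦ (qExpansion 1 f).coeff n
  set ζ := Complex.exp (2 * Real.pi * Complex.I / d) with hζ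
  set Q := Complex.exp (2 * Real.pi * Complex.I * (a * z) / d) with hQ
  have h1 : ∀ b ∈ Finset.range d,
      HasSum (fun n ↦ c n * Q ^ n * ζ ^ (n * b)) (f (ofComplex ((a * z + b) / d))) := by
    intro b _
    have him : 0 < ((a * z + b) / d : ℂ).im := by
      have : ((a * z + b) / d : ℂ) = ((a / d : ℝ) : ℂ) * z + ((b / d : ℝ) : ℂ) := by
        push_cast
        field_simp
      rw [this, Complex.add_im, Complex.im_ofReal_mul, Complex.ofReal_im, add_zero]
      have := z.im_pos
      positivity
    have h := ModularForm.hasSum_qExpansion f one_pos one_mem_strictPeriods_SL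
      (ofComplex ((a * z + b) / d))
    convert h using 2 with n
    rw [ofComplex_apply_of_im_pos him, mul_assoc]
    congr 1
    rw [Function.Periodic.qParam, pow_mul', hQ, hζ, ← Complex.exp_nat_mul _ b, ← mul_pow,
      ← Complex.exp_add]
    congr 2
    simp only [Complex.ofReal_one, div_one]
    field_simp
  have h2 := (hasSum_sum h1).mul_left ((m : ℂ) ^ (k - 1) * (d : ℂ) ^ (-k))
  have hs : ∀ n, ∑ b ∈ Finset.range d, ζ ^ (n * b) = if d ∣ n then (d : ℂ) else 0 :=
    fun n ↦ sum_range_exp d n hd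
  simp_rw [← Finset.mul_sum, hs] at h2
  rw [← Finset.mul_sum]
  -- One series is supported on multiples of `d`, the other on multiples of `a`; the terms at `d *
  -- l` and `a * l` agree.
  have hinj : Function.Injective fun l : ℕ ↦ d * l :=
    fun _ _ h ↦ Nat.eq_of_mul_eq_mul_left (Nat.pos_of_ne_zero hd) h
  have hinj' : Function.Injective fun l : ℕ ↦ a * l :=
    fun _ _ h ↦ Nat.eq_of_mul_eq_mul_left (Nat.pos_of_ne_zero ha) h
  rw [← hinj.hasSum_iff (by
    intro n hn
    have : ¬ d ∣ n := fun ⟨l, hl⟩ ↦ hn ⟨l, hl.symm⟩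
    simp [this])] at h2
  rw [← hinj'.hasSum_iff (by
    intro n hn
    have : ¬ a ∣ n := fun ⟨l, hl⟩ ↦ hn ⟨l, hl.symm⟩
    simp [this])]
  refine (congrArg (HasSum · _) (funext fun l ↦ ?_)).mpr h2
  have hQd : Q ^ (d * l) = Function.Periodic.qParam 1 z ^ (a * l) := by
    rw [hQ, Function.Periodic.qParam, ← Complex.exp_nat_mul, ← Complex.exp_nat_mul]
    congr 1
    push_cast
    field_simp
  simp only [Function.comp_apply, dvd_mul_right, if_true,
    Nat.mul_div_cancel_left l (Nat.pos_of_ne_zero ha), hQd,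
    smul_eq_mul]
  -- The extra factor `d` is the value of the root of unity sum.
  rw [show (1 - k) = -k + 1 by ring, zpow_add_one₀ hdC]
  ring

open MeasureTheory

/-! ### The standard fundamental domain -/

/-- The invariant measure has the nowhere vanishing density `y⁻²` with respect to Lebesgue measure.
-/
lemma volume_eq_zero_iff {s : Set ℍ} (hs : MeasurableSet s) :
    volume s = 0 ↔ volume (UpperHalfPlane.coe '' s) = 0 := by
  rw [volume_eq_lintegral, lintegral_eq_zero_iff (by fun_prop)]
  constructor
  · intro h
    rw [Filter.EventuallyEq, ae_restrict_iff' (measurableEmbedding_coe.measurableSet_image.mpr hs)]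
      at h
    refine measure_mono_null (fun z hz ↦ ?_) h
    obtain ⟨τ, hτ, rfl⟩ := hz
    intro h'
    have := h' ⟨τ, hτ, rfl⟩
    simp [τ.im_ne_zero] at this
  · intro h
    rw [Measure.restrict_eq_zero.mpr h, ae_zero]
    exact Filter.eventually_bot

instance : (volume : Measure ℍ).IsOpenPosMeasure where
  open_pos U hU hne h := by
    rw [volume_eq_zero_iff hU.measurableSet,
      (isOpenEmbedding_coe.isOpenMap U hU).measure_eq_zero_iff volume] at h
    exact hne.ne_empty (Set.image_eq_empty.mp h)

lemma volume_re_eq_zero (c : ℝ) : volume {z : ℂ | z.re = c} = 0 := by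
  have h := Complex.volume_preserving_equiv_real_prod.measure_preimage
    (s := {c} ×ˢ Set.univ) ((measurableSet_singleton c).prod .univ).nullMeasurableSet
  rw [Measure.volume_eq_prod, Measure.prod_prod, Real.volume_singleton, zero_mul] at h
  rw [← h]
  congr 1
  ext z
  simp

lemma volume_fd_diff_fdo : volume (ModularGroup.fd \ ModularGroup.fdo) = 0 := by
  rw [volume_eq_zero_iff
    (ModularGroup.isClosed_fd.measurableSet.diff ModularGroup.isOpen_fdo.measurableSet)]
  refine measure_mono_null (t := Metric.sphere (0 : ℂ) 1 ∪
    ({z : ℂ | z.re = 1 / 2} ∪ {z : ℂ | z.re = -(1 / 2)})) ?_ ?_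
  · rintro _ ⟨z, ⟨⟨h1, h2⟩, h3⟩, rfl⟩
    rw [Complex.one_le_normSq_iff] at h1
    by_cases h : 1 < ‖(z : ℂ)‖
    · right
      have h4 : ¬ |z.re| < 1 / 2 := fun h4 ↦ h3 ⟨Complex.one_lt_normSq_iff.mpr h, h4⟩
      have h5 : |z.re| = 1 / 2 := le_antisymm h2 (not_lt.mp h4)
      exact (abs_eq (by norm_num)).mp h5
    · left
      simpa using le_antisymm (not_lt.mp h) h1
  · rw [measure_union_null_iff, measure_union_null_iff]
    exact ⟨Measure.addHaar_sphere _ _ _, volume_re_eq_zero _, volume_re_eq_zero _⟩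

lemma volume_fd_lt_top : volume ModularGroup.fd < ⊤ := by
  rw [volume_eq_lintegral]
  -- On the fundamental domain `y ≥ √3 / 2`; any positive lower bound such as `1 / 4` makes the
  -- integral of `y⁻²` converge.
  set S : Set (ℝ × ℝ) := Set.Icc (-(1 / 2)) (1 / 2) ×ˢ Set.Ioi (1 / 4)
  have hsub : UpperHalfPlane.coe '' ModularGroup.fd ⊆ Complex.measurableEquivRealProd ⁻¹' S := by
    rintro _ ⟨z, hz, rfl⟩
    have h := ModularGroup.three_le_four_mul_im_sq_of_mem_fd hz
    have hz2 := abs_le.mp hz.2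
    refine ⟨⟨hz2.1, hz2.2⟩, ?_⟩
    change 1 / 4 < z.im
    nlinarith [z.im_pos]
  refine (lintegral_mono_set hsub).trans_lt ?_
  have h := Complex.volume_preserving_equiv_real_prod.setLIntegral_comp_preimage_emb
    Complex.measurableEquivRealProd.measurableEmbedding
    (fun p : ℝ × ℝ ↦ (((1 / ‖p.2‖₊) ^ 2 : NNReal) : ENNReal)) S
  refine h.trans_lt ?_
  rw [Measure.volume_eq_prod, ← Measure.prod_restrict, lintegral_prod _ (by fun_prop)]
  simp only [lintegral_const, Measure.restrict_apply .univ, Set.univ_inter, Real.volume_Icc]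
  refine ENNReal.mul_lt_top ?_ (by simp)
  have hi := integrableOn_Ioi_rpow_of_lt (a := -2) (by norm_num) (c := 1 / 4) (by norm_num)
  refine lt_of_le_of_lt (lintegral_mono_ae ?_) hi.2
  filter_upwards [ae_restrict_mem measurableSet_Ioi] with y hy
  have hy0 : 0 < y := lt_trans (by norm_num) hy
  rw [Real.rpow_neg hy0.le]
  simp [enorm_eq_nnnorm]

instance : Countable SL(2, ℤ) :=
  have : Countable (Matrix (Fin 2) (Fin 2) ℤ) := inferInstanceAs (Countable (Fin 2 → Fin 2 → ℤ))
  Subtype.val_injective.countable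

/-- Almost every orbit of `SL(2, ℤ)` meets the standard fundamental domain in exactly one point,
and this point has stabilizer `{1, -1}`. -/
lemma ae_exists_eq_or_eq_neg : ∀ᵐ z : ℍ, ∃ γ₀ : SL(2, ℤ), ∀ γ : SL(2, ℤ),
    γ • z ∈ ModularGroup.fd ↔ γ = γ₀ ∨ γ = -γ₀ := by
  -- The group is countable and preserves the measure, so almost no orbit meets the null boundary.
  have h : ∀ᵐ z : ℍ, ∀ γ : SL(2, ℤ), γ • z ∉ ModularGroup.fd \ ModularGroup.fdo := by
    rw [ae_all_iff]
    intro γ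
    have := (measurePreserving_smul (γ : GL (Fin 2) ℝ) (volume : Measure ℍ)).quasiMeasurePreserving
    exact this.ae (p := fun z ↦ z ∉ ModularGroup.fd \ ModularGroup.fdo)
      (measure_eq_zero_iff_ae_notMem.mp volume_fd_diff_fdo)
  filter_upwards [h] with z hz
  obtain ⟨γ₀, h₀⟩ := ModularGroup.exists_smul_mem_fd z
  refine ⟨γ₀, fun γ ↦ ⟨fun hγ ↦ ?_, ?_⟩⟩
  · have h₀' : γ₀ • z ∈ ModularGroup.fdo := by
      by_contra hn
      exact hz γ₀ ⟨h₀, hn⟩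
    have h1 : (γ * γ₀⁻¹) • γ₀ • z ∈ ModularGroup.fd := by rwa [mul_smul, inv_smul_smul]
    rcases ModularGroup.eq_one_or_neg_one_of_mem_fdo_mem_fd h₀' h1 with h2 | h2
    · left
      rwa [mul_inv_eq_one] at h2
    · right
      rw [mul_inv_eq_iff_eq_mul] at h2
      rw [h2, neg_mul, one_mul]
  · rintro (rfl | rfl)
    · exact h₀
    · rwa [ModularGroup.SL_neg_smul]

lemma tsum_indicator_fd (R : GL (Fin 2) ℝ) : ∀ᵐ z : ℍ, ∑' γ : SL(2, ℤ),
    {z : ℍ | γ • R • z ∈ ModularGroup.fd}.indicator (1 : ℍ → ENNReal) z = 2 := by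
  have := (measurePreserving_smul R (volume : Measure ℍ)).quasiMeasurePreserving
  filter_upwards [this.ae ae_exists_eq_or_eq_neg] with z ⟨γ₀, h⟩
  have hne : γ₀ ≠ -γ₀ := by
    intro h
    have h1 : ∀ i j, γ₀ i j = 0 := fun i j ↦ by
      have := congrArg (fun γ : SL(2, ℤ) ↦ γ i j) h
      simp at this
      omega
    have h2 := γ₀.2
    rw [Matrix.det_fin_two, h1, h1, h1] at h2
    simp at h2
  rw [tsum_eq_sum (s := {γ₀, -γ₀}) fun γ hγ ↦ ?_]
  · rw [Finset.sum_pair hne, Set.indicator_of_mem, Set.indicator_of_mem]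
    · simpa using one_add_one_eq_two
    · exact (h _).mpr (.inr rfl)
    · exact (h _).mpr (.inl rfl)
  · refine Set.indicator_of_notMem (fun hm ↦ hγ ?_) _
    simpa using (h γ).mp hm

lemma measurableSet_smul_smul_mem_fd (R : GL (Fin 2) ℝ) (γ : SL(2, ℤ)) :
    MeasurableSet {z : ℍ | γ • R • z ∈ ModularGroup.fd} := by
  have : Continuous fun z : ℍ ↦ (γ : GL (Fin 2) ℝ) • R • z :=
    (continuous_const_smul _).comp (continuous_const_smul R)
  exact (ModularGroup.isClosed_fd.preimage this).measurableSet

lemma sum_restrict_fd (R : GL (Fin 2) ℝ) :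
    Measure.sum (fun γ : SL(2, ℤ) ↦ (volume : Measure ℍ).restrict
      (ModularGroup.fd ∩ {z | γ • R • z ∈ ModularGroup.fd})) =
    (2 : ENNReal) • (volume : Measure ℍ).restrict ModularGroup.fd := by
  have hD := ModularGroup.isClosed_fd.measurableSet
  ext s hs
  rw [Measure.sum_apply _ hs, Measure.smul_apply, smul_eq_mul, Measure.restrict_apply hs]
  have h : ∀ γ : SL(2, ℤ), (volume : Measure ℍ).restrict
      (ModularGroup.fd ∩ {z | γ • R • z ∈ ModularGroup.fd}) s =
      ∫⁻ z in s ∩ ModularGroup.fd,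
        {z : ℍ | γ • R • z ∈ ModularGroup.fd}.indicator (1 : ℍ → ENNReal) z := by
    intro γ
    rw [lintegral_indicator_one (measurableSet_smul_smul_mem_fd R γ), Measure.restrict_apply hs,
      Measure.restrict_apply (measurableSet_smul_smul_mem_fd R γ), ← Set.inter_assoc,
      Set.inter_comm]
  simp_rw [h]
  rw [← lintegral_tsum fun γ ↦ (measurable_one.indicator
    (measurableSet_smul_smul_mem_fd R γ)).aemeasurable,
    lintegral_congr_ae (ae_restrict_of_ae (tsum_indicator_fd R)), setLIntegral_const]

/-- The domain is cut up according to which `γ` brings `R • z` back into it. The factor `2` appears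
because `γ` and `-γ` act alike. No invariance of `F` is needed. -/
lemma hasSum_setIntegral_fd (R : GL (Fin 2) ℝ) {F : ℍ → ℂ}
    (hF : IntegrableOn F ModularGroup.fd) :
    HasSum (fun γ : SL(2, ℤ) ↦ ∫ z in ModularGroup.fd ∩ {z | γ • R • z ∈ ModularGroup.fd}, F z)
      (2 * ∫ z in ModularGroup.fd, F z) := by
  have h := hasSum_integral_measure (f := F) (μ := fun γ : SL(2, ℤ) ↦ (volume : Measure ℍ).restrict
      (ModularGroup.fd ∩ {z | γ • R • z ∈ ModularGroup.fd})) (by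
    rw [sum_restrict_fd]
    exact hF.smul_measure (by simp))
  rw [sum_restrict_fd, integral_smul_measure] at h
  simpa using h

/-! ### Sums over integral matrices of fixed determinant -/

lemma smul_left_injective {m : ℤ} (hm : m ≠ 0) (R : FixedDetMatrix (Fin 2) ℤ m) :
    Function.Injective fun γ : SL(2, ℤ) ↦ γ • R := by
  intro γ γ' h
  have h1 := congrArg Subtype.val h
  simp only [FixedDetMatrices.smul_coe] at h1
  have h2 := congrArg (· * R.1.adjugate) h1
  simp only [Matrix.mul_assoc, Matrix.mul_adjugate, R.2, Matrix.mul_smul, Matrix.mul_one] at h2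
  exact Subtype.ext (smul_right_injective _ hm h2)

/-- Matrices of determinant `m` are the disjoint union of the left `SL(2, ℤ)`-orbits of the finitely
many representatives, each orbit being free. -/
lemma hasSum_of_orbits {m : ℤ} (hm : 0 < m) {u : FixedDetMatrix (Fin 2) ℤ m → ℂ}
    {c : FixedDetMatrices.reps m → ℂ}
    (h : ∀ R, HasSum (fun γ : SL(2, ℤ) ↦ u (γ • R.1)) (c R)) : HasSum u (∑ R, c R) := by
  classical
  have h1 : ∀ R : FixedDetMatrices.reps m,
      HasSum ((Set.range fun γ : SL(2, ℤ) ↦ γ • R.1).indicator u) (c R) := by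
    intro R
    rw [← hasSum_subtype_iff_indicator]
    exact (smul_left_injective hm.ne' R.1).hasSum_range_iff.mpr (h R)
  convert hasSum_sum fun R (_ : R ∈ Finset.univ) ↦ h1 R with A
  obtain ⟨R, δ, rfl⟩ := exists_reps hm.ne' A
  rw [Finset.sum_eq_single R]
  · exact (Set.indicator_of_mem (Set.mem_range_self (f := fun γ : SL(2, ℤ) ↦ γ • R.1) δ) u).symm
  · intro R' _ hne
    refine Set.indicator_of_notMem ?_ _
    rintro ⟨δ', h'⟩
    refine hne (Subtype.ext (reps_unique hm R'.2 R.2 (δ'⁻¹ * δ) ?_))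
    dsimp only at h'
    rw [mul_smul, ← h', inv_smul_smul]
  · simp

/-- The adjugate of an integral `2 × 2` matrix of determinant `m`. -/
def adj {m : ℤ} (A : FixedDetMatrix (Fin 2) ℤ m) : FixedDetMatrix (Fin 2) ℤ m :=
  ⟨A.1.adjugate, by rw [Matrix.det_adjugate, A.2]; simp⟩

lemma adj_involutive {m : ℤ} : Function.Involutive (adj (m := m)) := fun A ↦
  Subtype.ext (by
    change A.1.adjugate.adjugate = A.1
    rw [Matrix.adjugate_adjugate _ (by simp)]
    simp)

lemma toGL_adj_mul {m : ℤ} (hm : m ≠ 0) (A : FixedDetMatrix (Fin 2) ℤ m) (i j : Fin 2) :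
    (toGL hm (adj A) * toGL hm A) i j = if i = j then (m : ℝ) else 0 := by
  have h : A.1.adjugate * A.1 = m • 1 := by rw [Matrix.adjugate_mul, A.2]
  have h1 := congrFun (congrFun h i) j
  rw [Matrix.mul_apply] at h1
  have h2 : (toGL hm (adj A) * toGL hm A) i j = ((∑ l, A.1.adjugate i l * A.1 l j : ℤ) : ℝ) := by
    simp only [Matrix.GeneralLinearGroup.coe_mul, Matrix.mul_apply, toGL_apply]
    push_cast
    rfl
  rw [h2, h1]
  simp [Matrix.one_apply]

lemma scalar_smul {m : ℝ} (hm : 0 < m) {S : GL (Fin 2) ℝ}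
    (hS : ∀ i j, S i j = if i = j then m else 0) (z : ℍ) : S • z = z := by
  have hdet : S.det.val = m ^ 2 := by
    change S.1.det = _
    rw [Matrix.det_fin_two]
    simp [hS, sq]
  have hpos : 0 < S.det.val := by rw [hdet]; positivity
  have hm' : (m : ℂ) ≠ 0 := by exact_mod_cast hm.ne'
  apply UpperHalfPlane.ext
  rw [coe_smul_of_det_pos hpos]
  simp [num, denom, hS, hm']

lemma slash_scalar (k : ℤ) {m : ℝ} (hm : 0 < m) {S : GL (Fin 2) ℝ}
    (hS : ∀ i j, S i j = if i = j then m else 0) (f : ℍ → ℂ) :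
    f ∣[k] S = (m : ℂ) ^ (k - 2) • f := by
  have hdet : S.det.val = m ^ 2 := by
    change S.1.det = _
    rw [Matrix.det_fin_two]
    simp [hS, sq]
  have hpos : 0 < S.det.val := by rw [hdet]; positivity
  have hm' : (m : ℂ) ≠ 0 := by exact_mod_cast hm.ne'
  ext z
  rw [ModularForm.slash_apply, scalar_smul hm hS, σ, if_pos hpos, hdet, denom, hS, hS]
  simp only [ContinuousAlgEquiv.coe_refl', id, Pi.smul_apply, smul_eq_mul]
  simp
  rw [mul_assoc, mul_comm, ← zpow_natCast, ← zpow_mul, ← zpow_neg, ← zpow_add₀ hm']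
  congr 2
  push_cast
  ring

/-! ### Self-adjointness of Hecke operators -/

/-- Since `adj A * A` is the scalar `m`, slashing by `A` after `adj A` only multiplies by `m ^ (k -
2)`, which is also the factor in `petersson_slash`. -/
lemma petersson_slash_left (k : ℤ) {m : ℤ} (hm : 0 < m) (f g : ℍ → ℂ)
    (A : FixedDetMatrix (Fin 2) ℤ m) (z : ℍ) :
    petersson k (f ∣[k] toGL hm.ne' A) g z =
      petersson k f (g ∣[k] toGL hm.ne' (adj A)) (toGL hm.ne' A • z) := by
  have hmR : (0 : ℝ) < m := by exact_mod_cast hm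
  have hmC : (m : ℂ) ≠ 0 := by exact_mod_cast hm.ne'
  have h := petersson_slash k f (g ∣[k] toGL hm.ne' (adj A)) (toGL hm.ne' A) z
  rw [← SlashAction.slash_mul, slash_scalar k hmR (toGL_adj_mul hm.ne' A), det_toGL, σ, if_pos
    (by rw [det_toGL]; exact hmR), abs_of_pos hmR] at h
  simp only [petersson, Pi.smul_apply, smul_eq_mul] at h ⊢
  simp only [ContinuousAlgEquiv.coe_refl', id, Complex.ofReal_intCast] at h
  have h0 : (m : ℂ) ^ (k - 2) ≠ 0 := zpow_ne_zero _ hmC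
  apply mul_left_cancel₀ h0
  rw [← h]
  ring

lemma integrableOn_petersson {k : ℤ} {f g : ℍ → ℂ} (hf : Continuous f) (hg : Continuous g)
    (hfb : ∃ C, ∀ z, ‖petersson k f f z‖ ≤ C) (hgb : ∃ C, ∀ z, ‖petersson k g g z‖ ≤ C) :
    IntegrableOn (petersson k f g) ModularGroup.fd := by
  obtain ⟨C, hC⟩ := hfb
  obtain ⟨C', hC'⟩ := hgb
  refine Measure.integrableOn_of_bounded (M := C + C') volume_fd_lt_top.ne
    (petersson_continuous k hf hg).aestronglyMeasurable (Filter.Eventually.of_forall fun z ↦ ?_)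
  refine le_trans ?_ (add_le_add (hC z) (hC' z))
  simp only [petersson, norm_mul, Complex.norm_conj, ← add_mul]
  gcongr
  -- The bound is `|f| |g| ≤ |f|² + |g|²`.
  nlinarith [sq_nonneg (‖f z‖ - ‖g z‖), norm_nonneg (f z), norm_nonneg (g z)]

variable {k : ℤ}

lemma _root_.CuspForm.exists_petersson_self_le (f : CuspForm 𝒮ℒ k) :
    ∃ C, ∀ z, ‖petersson k f f z‖ ≤ C :=
  CuspFormClass.petersson_bounded_left k 𝒮ℒ f f

lemma _root_.CuspForm.continuous (f : CuspForm 𝒮ℒ k) : Continuous f :=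
  (CuspFormClass.holo f).continuous

lemma _root_.CuspForm.integrableOn_petersson (f g : CuspForm 𝒮ℒ k) :
    IntegrableOn (petersson k f g) ModularGroup.fd :=
  Maeda.integrableOn_petersson f.continuous g.continuous f.exists_petersson_self_le
    g.exists_petersson_self_le

lemma _root_.CuspForm.integrableOn_petersson_slash (f g : CuspForm 𝒮ℒ k) (A : GL (Fin 2) ℝ) :
    IntegrableOn (petersson k (f ∣[k] A) g) ModularGroup.fd := by
  refine Maeda.integrableOn_petersson ((CuspFormClass.holo f).slash k A).continuous g.continuous ?_
    g.exists_petersson_self_le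
  obtain ⟨C, hC⟩ := f.exists_petersson_self_le
  refine ⟨|A.det.val| ^ (k - 2) * C, fun z ↦ ?_⟩
  rw [petersson_slash, norm_mul, norm_σ, norm_zpow, Complex.norm_real, Real.norm_eq_abs, abs_abs]
  gcongr
  exact hC _

/-- The contribution of a matrix `A` to the unfolded inner product `⟨T_m f, g⟩`. -/
def unfolded (k : ℤ) {m : ℤ} (hm : m ≠ 0) (f g : ℍ → ℂ) (A : FixedDetMatrix (Fin 2) ℤ m) : ℂ :=
  ∫ z in ModularGroup.fd ∩ {z | toGL hm A • z ∈ ModularGroup.fd},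
    petersson k (f ∣[k] toGL hm A) g z

lemma petersson_sum_left {ι : Type*} (s : Finset ι) (F : ι → ℍ → ℂ) (g : ℍ → ℂ) (z : ℍ) :
    petersson k (∑ i ∈ s, F i) g z = ∑ i ∈ s, petersson k (F i) g z := by
  simp only [petersson, Finset.sum_apply, map_sum, Finset.sum_mul]

lemma peterssonInner_heckeOperator (m : ℕ+) (f g : CuspForm 𝒮ℒ k)
    (hm : ((m : ℕ) : ℤ) ≠ 0) :
    peterssonInner k (heckeOperator k m f) g = ∑ A : FixedDetMatrices.reps ((m : ℕ) : ℤ),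
      ∫ z in ModularGroup.fd, petersson k (f ∣[k] toGL hm A.1) g z := by
  rw [← integral_finsetSum _ fun A _ ↦ f.integrableOn_petersson_slash g _]
  refine integral_congr_ae (.of_forall fun z ↦ ?_)
  change petersson k (heckeFun k m f) g z = _
  rw [heckeFun, petersson_sum_left]

/-- By invariance of `f`, the form `f ∣[k] (γ R)` equals `f ∣[k] R`, so the sum over representatives
unfolds to one over all matrices of determinant `m`. That index set, unlike the representatives, is
stable under `adj`. -/
lemma hasSum_unfolded (m : ℕ+) (f g : CuspForm 𝒮ℒ k) (hm : ((m : ℕ) : ℤ) ≠ 0) :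
    HasSum (unfolded k hm f g) (2 * peterssonInner k (heckeOperator k m f) g) := by
  rw [peterssonInner_heckeOperator m f g hm, Finset.mul_sum]
  refine hasSum_of_orbits (by exact_mod_cast m.pos) fun R ↦ ?_
  have h := hasSum_setIntegral_fd (toGL hm R.1) (f.integrableOn_petersson_slash g (toGL hm R.1))
  convert h using 2 with γ
  have hf : (f : ℍ → ℂ) ∣[k] (γ : GL (Fin 2) ℝ) = f := f.slash_action_eq' _ ⟨γ, rfl⟩
  rw [unfolded, toGL_smul, SlashAction.slash_mul, hf]
  simp_rw [mul_smul]
  rfl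

/-- Substitute `w = A • z`: since `adj A` undoes `A` on `ℍ`, the two conditions cutting out the
region of integration trade places. -/
lemma unfolded_adj (f g : ℍ → ℂ) {m : ℤ} (hm : 0 < m) (A : FixedDetMatrix (Fin 2) ℤ m) :
    unfolded k hm.ne' f g A = (starRingEnd ℂ) (unfolded k hm.ne' g f (adj A)) := by
  rw [unfolded, unfolded, ← integral_conj]
  simp_rw [← petersson_symm, petersson_slash_left k hm f g A]
  refine Eq.trans ?_ ((measurePreserving_smul (toGL hm.ne' A) volume).setIntegral_preimage_emb
    (measurableEmbedding_const_smul _) (petersson k f (g ∣[k] toGL hm.ne' (adj A)))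
    (ModularGroup.fd ∩ {z | toGL hm.ne' (adj A) • z ∈ ModularGroup.fd}))
  congr 2
  ext z
  simp only [Set.preimage_inter, Set.mem_inter_iff, Set.mem_preimage, Set.mem_ofPred_eq, ← mul_smul]
  rw [scalar_smul (by exact_mod_cast hm) (toGL_adj_mul hm.ne' A), and_comm]

lemma peterssonInner_symm (f g : ℍ → ℂ) :
    peterssonInner k g f = (starRingEnd ℂ) (peterssonInner k f g) := by
  rw [peterssonInner, peterssonInner, ← integral_conj]
  simp_rw [← petersson_symm]

/-- Hecke operators are self-adjoint for the Petersson inner product. -/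
theorem peterssonInner_heckeOperator_comm (m : ℕ+) (f g : CuspForm 𝒮ℒ k) :
    peterssonInner k (heckeOperator k m f) g = peterssonInner k f (heckeOperator k m g) := by
  have hm : (0 : ℤ) < ((m : ℕ) : ℤ) := by exact_mod_cast m.pos
  have h1 := hasSum_unfolded m f g hm.ne'
  have h2 := hasSum_unfolded m g f hm.ne'
  have h3 := (Complex.hasSum_conj'.mpr h2)
  have h4 := (adj_involutive.toPerm.hasSum_iff.mpr h3)
  have h5 : (fun A ↦ (starRingEnd ℂ) (unfolded k hm.ne' g f A)) ∘ (adj_involutive.toPerm) =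
      unfolded k hm.ne' f g := funext fun A ↦ (unfolded_adj f g hm A).symm
  rw [h5] at h4
  have h6 := h1.unique h4
  rw [map_mul, ← peterssonInner_symm, map_ofNat] at h6
  exact mul_left_cancel₀ two_ne_zero h6

/-- The Petersson inner product is definite. -/
theorem peterssonInner_self_ne_zero {g : CuspForm 𝒮ℒ k} (hg : g ≠ 0) :
    peterssonInner k g g ≠ 0 := by
  intro h
  apply hg
  set p : ℍ → ℝ := fun z ↦ ‖g z‖ ^ 2 * z.im ^ k with hp
  have hpet : ∀ z, petersson k g g z = (p z : ℂ) := by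
    intro z
    rw [petersson, Complex.conj_mul', hp]
    push_cast
    rfl
  have hp0 : ∀ z, 0 ≤ p z := fun z ↦ by
    have := z.im_pos
    positivity
  have hpc : Continuous p := by
    have := petersson_continuous k g.continuous g.continuous
    have h := Complex.continuous_re.comp this
    convert h using 1
    ext z
    simp [hpet]
  rw [peterssonInner] at h
  simp_rw [hpet] at h
  have h' : ∫ z in ModularGroup.fd, (p z : ℂ) = ((∫ z in ModularGroup.fd, p z : ℝ) : ℂ) :=
    integral_ofReal
  rw [h', Complex.ofReal_eq_zero] at h
  have hint : IntegrableOn p ModularGroup.fd := by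
    have hre : p = fun z ↦ RCLike.re (petersson k g g z) := by
      ext z
      simp [hpet]
    rw [hre]
    exact (g.integrableOn_petersson g).re
  rw [setIntegral_eq_zero_iff_of_nonneg_ae (.of_forall hp0) hint,
    Filter.EventuallyEq, ae_restrict_iff' ModularGroup.isClosed_fd.measurableSet] at h
  -- A continuous function vanishing almost everywhere vanishes on the open domain, then on its
  -- closure, then everywhere by invariance.
  have hfdo : ∀ z ∈ ModularGroup.fdo, p z = 0 := by
    have hopen : IsOpen (ModularGroup.fdo ∩ {z | p z ≠ 0}) :=
      ModularGroup.isOpen_fdo.inter (isOpen_ne_fun hpc continuous_const)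
    have hnull : volume (ModularGroup.fdo ∩ {z | p z ≠ 0}) = 0 := by
      refine measure_mono_null (fun z hz ↦ ?_) h
      exact fun h' ↦ hz.2 (h' (ModularGroup.fdo_subset_fd hz.1))
    intro z hz
    by_contra hne
    have := (hopen.measure_eq_zero_iff volume).mp hnull
    exact Set.notMem_empty z (this ▸ ⟨hz, hne⟩)
  have hfd : ∀ z ∈ ModularGroup.fd, p z = 0 := by
    intro z hz
    rw [ModularGroup.fd_eq_closure_fdo] at hz
    have : IsClosed {z | p z = 0} := isClosed_eq hpc continuous_const
    exact this.closure_subset_iff.mpr hfdo hz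
  ext z
  obtain ⟨γ, hγ⟩ := ModularGroup.exists_smul_mem_fd z
  have h1 : p z = 0 := by
    have h2 : petersson k g g ((γ : GL (Fin 2) ℝ) • z) = petersson k g g z :=
      SlashInvariantFormClass.petersson_smul (Γ := 𝒮ℒ) ⟨γ, rfl⟩
    rw [hpet, hpet] at h2
    have h3 := Complex.ofReal_injective h2
    rw [← h3]
    exact hfd _ hγ
  have h4 : z.im ^ k ≠ 0 := zpow_ne_zero _ z.im_ne_zero
  simpa [hp, h4] using h1

/-! ### Normalized eigenforms -/

/-- The `n`-th Fourier coefficient as a linear functional on cusp forms. -/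
def fourierCoeff (n : ℕ) : CuspForm 𝒮ℒ k →ₗ[ℂ] ℂ where
  toFun f := (qExpansion 1 f).coeff n
  map_add' f g := by
    rw [FunLike.coe_add, ModularForm.qExpansion_add one_pos one_mem_strictPeriods_SL, map_add]
  map_smul' c f := by
    rw [FunLike.coe_smul, ModularForm.qExpansion_smul one_pos one_mem_strictPeriods_SL,
      PowerSeries.coeff_smul]
    rfl

lemma fourierCoeff_zero (f : CuspForm 𝒮ℒ k) : fourierCoeff 0 f = 0 :=
  CuspFormClass.qExpansion_coeff_zero f one_pos one_mem_strictPeriods_SL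

lemma ext_fourierCoeff {f g : CuspForm 𝒮ℒ k}
    (h : ∀ m : ℕ+, fourierCoeff m f = fourierCoeff m g) : f = g := by
  refine cuspForm_ext_qExpansion (PowerSeries.ext fun n ↦ ?_)
  change fourierCoeff n f = fourierCoeff n g
  rcases Nat.eq_zero_or_pos n with rfl | hn
  · rw [fourierCoeff_zero, fourierCoeff_zero]
  · exact h ⟨n, hn⟩

lemma fourierCoeff_heckeOperator (m : ℕ+) (f : CuspForm 𝒮ℒ k) (n : ℕ) :
    fourierCoeff n (heckeOperator k m f) =
      ∑ x ∈ (m : ℕ).divisorsAntidiagonal, if x.1 ∣ n then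
        (m : ℂ) ^ (k - 1) * (x.2 : ℂ) ^ (1 - k) * fourierCoeff (x.2 * (n / x.1)) f
      else 0 :=
  coeff_heckeOperator k m f n

/-- Only the divisor pair `(1, m)` contributes. Hence the first coefficients of the `T_m f`
determine `f`, and the eigenvalues of a normalized eigenform are its coefficients. -/
lemma fourierCoeff_one_heckeOperator (m : ℕ+) (f : CuspForm 𝒮ℒ k) :
    fourierCoeff 1 (heckeOperator k m f) = fourierCoeff m f := by
  have hm : ((m : ℕ) : ℂ) ≠ 0 := by exact_mod_cast m.ne_zero
  rw [fourierCoeff_heckeOperator, Finset.sum_eq_single (1, (m : ℕ))]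
  · rw [if_pos (dvd_refl 1), ← zpow_add₀ hm]
    simp
  · rintro ⟨a, d⟩ hx hne
    refine if_neg fun h ↦ hne ?_
    have ha : a = 1 := Nat.dvd_one.mp h
    have := (Nat.mem_divisorsAntidiagonal.mp hx).1
    simp_all
  · simp

lemma fourierCoeff_heckeOperator_map (σ : ℂ ≃+* ℂ) {f f' : CuspForm 𝒮ℒ k}
    (h : ∀ n, fourierCoeff n f' = σ (fourierCoeff n f)) (m : ℕ+) (n : ℕ) :
    fourierCoeff n (heckeOperator k m f') = σ (fourierCoeff n (heckeOperator k m f)) := by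
  rw [fourierCoeff_heckeOperator, fourierCoeff_heckeOperator, map_sum]
  refine Finset.sum_congr rfl fun x _ ↦ ?_
  split_ifs
  · rw [map_mul, map_mul, map_zpow₀, map_zpow₀, map_natCast, map_natCast, h]
  · rw [map_zero]

lemma exists_fourierCoeff_map (σ : ℂ ≃+* ℂ) (f : CuspForm 𝒮ℒ k) :
    ∃ f' : CuspForm 𝒮ℒ k, ∀ n, fourierCoeff n f' = σ (fourierCoeff n f) := by
  obtain ⟨f', h⟩ := exists_cuspForm_qExpansion_map (σ : ℂ →+* ℂ) f
  exact ⟨f', fun n ↦ congrArg (PowerSeries.coeff n) h⟩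

variable (k) in
/-- Cusp eigenforms with first Fourier coefficient `1`. -/
def NormalizedEigenform : Type :=
  {f : CuspForm 𝒮ℒ k // IsHeckeEigenform f ∧ fourierCoeff 1 f = 1}

namespace NormalizedEigenform

lemma fourierCoeff_one (f : NormalizedEigenform k) : fourierCoeff 1 f.1 = 1 := f.2.2

lemma ne_zero (f : NormalizedEigenform k) : f.1 ≠ 0 := fun h ↦ by
  have := f.fourierCoeff_one
  rw [h, map_zero] at this
  exact zero_ne_one this

lemma heckeOperator_apply (f : NormalizedEigenform k) (m : ℕ+) :
    heckeOperator k m f.1 = fourierCoeff m f.1 • f.1 := by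
  obtain ⟨a, ha⟩ := f.2.1 m
  rw [ha, ← fourierCoeff_one_heckeOperator, ha, map_smul, f.fourierCoeff_one, smul_eq_mul, mul_one]

/-- The conjugate form is chosen, but its coefficients determine it, which yields the action laws.
-/
instance : MulAction (ℂ ≃+* ℂ) (NormalizedEigenform k) where
  smul σ f := ⟨(exists_fourierCoeff_map σ f.1).choose, by
    have h := (exists_fourierCoeff_map σ f.1).choose_spec
    refine ⟨fun m ↦ ⟨σ (fourierCoeff m f.1), ext_fourierCoeff fun n ↦ ?_⟩, ?_⟩
    · rw [fourierCoeff_heckeOperator_map σ h, f.heckeOperator_apply, LinearMap.map_smul,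
        LinearMap.map_smul, h,
        smul_eq_mul, smul_eq_mul, map_mul]
    · rw [h, f.fourierCoeff_one, map_one]⟩
  one_smul f := Subtype.ext (ext_fourierCoeff fun n ↦
    (exists_fourierCoeff_map 1 f.1).choose_spec n)
  mul_smul σ τ f := Subtype.ext (ext_fourierCoeff fun n ↦ by
    refine ((exists_fourierCoeff_map (σ * τ) f.1).choose_spec n).trans ?_
    refine Eq.symm (((exists_fourierCoeff_map σ _).choose_spec n).trans ?_)
    exact congrArg σ ((exists_fourierCoeff_map τ f.1).choose_spec n))

lemma fourierCoeff_smul (σ : ℂ ≃+* ℂ) (f : NormalizedEigenform k) (n : ℕ) :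
    fourierCoeff n (σ • f).1 = σ (fourierCoeff n f.1) :=
  (exists_fourierCoeff_map σ f.1).choose_spec n

lemma apply_eq_smul (f : NormalizedEigenform k) {t : Module.End ℂ (CuspForm 𝒮ℒ k)}
    (ht : t ∈ heckeAlgebra k) : t f.1 = fourierCoeff 1 (t f.1) • f.1 := by
  suffices ∃ c : ℂ, t f.1 = c • f.1 by
    obtain ⟨c, hc⟩ := this
    rw [hc, map_smul, f.fourierCoeff_one, smul_eq_mul, mul_one]
  induction ht using Algebra.adjoin_induction with
  | mem t ht =>
    obtain ⟨m, rfl⟩ := ht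
    exact f.2.1 m
  | algebraMap r => exact ⟨(r : ℂ), rfl⟩
  | add s t _ _ hs ht =>
    obtain ⟨c, hc⟩ := hs
    obtain ⟨d, hd⟩ := ht
    exact ⟨c + d, by rw [LinearMap.add_apply, hc, hd, add_smul]⟩
  | mul s t _ _ hs ht =>
    obtain ⟨c, hc⟩ := hs
    obtain ⟨d, hd⟩ := ht
    exact ⟨d * c, by rw [Module.End.mul_apply, hd, map_smul, hc, smul_smul]⟩

/-- The character by which the Hecke algebra acts on an eigenform. -/
def eigenChar (f : NormalizedEigenform k) : heckeAlgebra k →ₐ[ℚ] ℂ :=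
  RingHom.toRatAlgHom
    { toFun t := fourierCoeff 1 (t.1 f.1)
      map_one' := f.fourierCoeff_one
      map_mul' s t := by
        change fourierCoeff 1 (s.1 (t.1 f.1)) = _
        rw [f.apply_eq_smul t.2, map_smul, map_smul, map_smul, f.fourierCoeff_one, smul_eq_mul,
          smul_eq_mul, mul_one, mul_comm]
      map_zero' := map_zero _
      map_add' s t := map_add (fourierCoeff 1) (s.1 f.1) (t.1 f.1) }

variable (k) in
/-- `T_m` as an element of the Hecke algebra. -/
def _root_.Maeda.heckeElement (m : ℕ+) : heckeAlgebra k :=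
  ⟨heckeOperator k m, Algebra.subset_adjoin ⟨m, rfl⟩⟩

lemma eigenChar_heckeElement (f : NormalizedEigenform k) (m : ℕ+) :
    f.eigenChar (heckeElement k m) = fourierCoeff m f.1 :=
  fourierCoeff_one_heckeOperator m f.1

lemma _root_.Maeda.heckeAlgebra_algHom_ext {φ ψ : heckeAlgebra k →ₐ[ℚ] ℂ}
    (h : ∀ m, φ (heckeElement k m) = ψ (heckeElement k m)) : φ = ψ := by
  refine AlgHom.adjoin_ext ?_
  rintro _ ⟨m, rfl⟩
  exact h m

lemma eigenChar_injective : Function.Injective (eigenChar (k := k)) := fun f g h ↦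
  Subtype.ext (ext_fourierCoeff fun m ↦ by
    rw [← eigenChar_heckeElement, h, eigenChar_heckeElement])

lemma eigenChar_smul (σ : ℂ ≃+* ℂ) (f : NormalizedEigenform k) (t : heckeAlgebra k) :
    (σ • f).eigenChar t = σ (f.eigenChar t) := by
  have h : (σ • f).eigenChar = ((σ : ℂ →+* ℂ).toRatAlgHom).comp f.eigenChar := by
    refine heckeAlgebra_algHom_ext fun m ↦ ?_
    rw [eigenChar_heckeElement, fourierCoeff_smul, ← eigenChar_heckeElement]
    rfl
  rw [h]
  rfl

end NormalizedEigenform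

lemma IsHeckeEigenform.exists_eq_smul {f : CuspForm 𝒮ℒ k} (hf : IsHeckeEigenform f) (h0 : f ≠ 0) :
    ∃ (f₀ : NormalizedEigenform k) (c : ℂ), c ≠ 0 ∧ f = c • f₀.1 := by
  have h1 : fourierCoeff 1 f ≠ 0 := by
    intro h1
    refine h0 (ext_fourierCoeff fun m ↦ ?_)
    obtain ⟨a, ha⟩ := hf m
    rw [← fourierCoeff_one_heckeOperator, ha, map_smul, h1, smul_zero, map_zero]
  refine ⟨⟨(fourierCoeff 1 f)⁻¹ • f, fun m ↦ ?_, ?_⟩, fourierCoeff 1 f, h1, ?_⟩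
  · obtain ⟨a, ha⟩ := hf m
    exact ⟨a, by rw [map_smul, ha, smul_comm]⟩
  · rw [map_smul, smul_eq_mul, inv_mul_cancel₀ h1]
  · rw [smul_inv_smul₀ h1]

/-! ### Consequences of Maeda's conjecture -/

variable (k) in
/-- The pairing of a cusp form with Hecke operators through the first Fourier coefficient. -/
def heckePairing : CuspForm 𝒮ℒ k →ₗ[ℂ] (heckeAlgebra k → ℂ) :=
  LinearMap.pi fun t ↦ (fourierCoeff 1).comp t.1

/-- The pairing sends an eigenform to its eigencharacter, and distinct characters are linearly
independent. -/
lemma NormalizedEigenform.linearIndependent :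
    LinearIndependent ℂ fun f : NormalizedEigenform k ↦ f.1 := by
  refine LinearIndependent.of_comp (heckePairing k) ?_
  have h := (linearIndependent_monoidHom (heckeAlgebra k) ℂ).comp
    (fun f : NormalizedEigenform k ↦ (f.eigenChar : heckeAlgebra k →* ℂ)) fun f g h ↦
      eigenChar_injective (AlgHom.ext fun t ↦ DFunLike.congr_fun h t)
  exact h

/-- A form is determined by the first coefficients of its images under a `ℚ`-basis of the Hecke
algebra, since these give the first coefficient of every `T_m f`. -/
lemma finrank_cuspForm_le [Module.Finite ℚ (heckeAlgebra k)] :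
    Module.finrank ℂ (CuspForm 𝒮ℒ k) ≤ Module.finrank ℚ (heckeAlgebra k) := by
  let b := Module.finBasis ℚ (heckeAlgebra k)
  let Λ : CuspForm 𝒮ℒ k →ₗ[ℂ] (Fin (Module.finrank ℚ (heckeAlgebra k)) → ℂ) :=
    LinearMap.pi fun i ↦ (fourierCoeff 1).comp (b i).1
  have hΛ : Function.Injective Λ := by
    rw [← LinearMap.ker_eq_bot, LinearMap.ker_eq_bot']
    intro f hf
    have h : ∀ t : heckeAlgebra k, fourierCoeff 1 (t.1 f) = 0 := by
      intro t
      rw [← b.sum_repr t, AddSubmonoidClass.coe_finsetSum, LinearMap.sum_apply, map_sum]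
      refine Finset.sum_eq_zero fun i _ ↦ ?_
      have h1 : (b.repr t i • b i).1 f = ((b.repr t i : ℚ) : ℂ) • (b i).1 f := by
        rw [Algebra.smul_def]
        rfl
      rw [h1, map_smul]
      have h2 : fourierCoeff 1 ((b i).1 f) = 0 := congrFun hf i
      rw [h2, smul_zero]
    refine ext_fourierCoeff fun m ↦ ?_
    rw [map_zero, ← fourierCoeff_one_heckeOperator]
    exact h (heckeElement k m)
  simpa using LinearMap.finrank_le_finrank_of_injective hΛ

instance : FiniteDimensional ℂ (CuspForm 𝒮ℒ k) :=
  .of_injective CuspForm.toModularFormₗ CuspForm.toModularFormₗ_injective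

section NumberField

variable {K : Type} [Field K] [NumberField K] (e : heckeAlgebra k ≃ₐ[ℚ] K)

include e in
/-- If the Hecke algebra is a number field, then every one of its complex characters is the
eigencharacter of some eigenform. -/
lemma NormalizedEigenform.eigenChar_bijective (f₀ : NormalizedEigenform k) :
    Function.Bijective (eigenChar (k := k)) := by
  refine ⟨eigenChar_injective, fun φ ↦ ?_⟩
  -- Both characters are embeddings of `K`, hence conjugate under an automorphism of `ℂ`.
  obtain ⟨σ, hσ⟩ := exists_ringEquiv_comp_eq (F := K)
    ((f₀.eigenChar.comp e.symm.toAlgHom : K →ₐ[ℚ] ℂ) : K →+* ℂ)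
    ((φ.comp e.symm.toAlgHom : K →ₐ[ℚ] ℂ) : K →+* ℂ)
  refine ⟨σ • f₀, AlgHom.ext fun t ↦ ?_⟩
  rw [eigenChar_smul]
  simpa using hσ (e t)

/-- If the Hecke algebra is a number field `K`, then eigenforms correspond to the complex
embeddings of `K`. -/
def NormalizedEigenform.equivAlgHom (f₀ : NormalizedEigenform k) :
    NormalizedEigenform k ≃ (K →ₐ[ℚ] ℂ) :=
  (Equiv.ofBijective _ (NormalizedEigenform.eigenChar_bijective e f₀)).trans
    (e.arrowCongr AlgEquiv.refl)

lemma NormalizedEigenform.equivAlgHom_apply (f₀ f : NormalizedEigenform k) (t : heckeAlgebra k) :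
    NormalizedEigenform.equivAlgHom e f₀ f (e t) = f.eigenChar t := by
  simp [equivAlgHom]

include e in
lemma NormalizedEigenform.finite (f₀ : NormalizedEigenform k) : Finite (NormalizedEigenform k) :=
  Finite.of_equiv _ (NormalizedEigenform.equivAlgHom e f₀).symm

include e in
-- Independence bounds the count by the dimension, which is at most `[K : ℚ]`, the number of complex
-- embeddings of `K` and so of eigenforms.
lemma NormalizedEigenform.card_eq_finrank (f₀ : NormalizedEigenform k) :
    Nat.card (NormalizedEigenform k) = Module.finrank ℂ (CuspForm 𝒮ℒ k) := by
  have := NormalizedEigenform.finite e f₀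
  have hfin : Module.Finite ℚ (heckeAlgebra k) := .equiv e.symm.toLinearEquiv
  have := Fintype.ofFinite (NormalizedEigenform k)
  refine le_antisymm ?_ ?_
  · rw [Nat.card_eq_fintype_card]
    exact NormalizedEigenform.linearIndependent.fintype_card_le_finrank
  · refine finrank_cuspForm_le.trans (le_of_eq ?_)
    rw [Nat.card_congr (NormalizedEigenform.equivAlgHom e f₀), Nat.card_eq_fintype_card,
      AlgHom.card, e.toLinearEquiv.finrank_eq]

include e in
/-- The restrictions of automorphisms of `ℂ` to the normal closure of `K` act faithfully on
eigenforms. -/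
lemma eq_on_normalClosure (f₀ : NormalizedEigenform k) {σ σ' : ℂ ≃+* ℂ}
    (h : ∀ f : NormalizedEigenform k, σ • f = σ' • f) {x : ℂ}
    (hx : x ∈ IntermediateField.normalClosure ℚ K ℂ) : σ x = σ' x := by
  let E : IntermediateField ℚ ℂ :=
    ((σ : ℂ →+* ℂ).eqLocusField (σ' : ℂ →+* ℂ)).toIntermediateField fun q ↦ by
      change σ (algebraMap ℚ ℂ q) = σ' (algebraMap ℚ ℂ q)
      simp
  suffices IntermediateField.normalClosure ℚ K ℂ ≤ E from this hx
  rw [normalClosure_def, iSup_le_iff]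
  rintro φ _ ⟨y, rfl⟩
  obtain ⟨f, rfl⟩ := (NormalizedEigenform.equivAlgHom e f₀).surjective φ
  obtain ⟨t, rfl⟩ := e.surjective y
  change σ (NormalizedEigenform.equivAlgHom e f₀ f (e t)) =
    σ' (NormalizedEigenform.equivAlgHom e f₀ f (e t))
  rw [NormalizedEigenform.equivAlgHom_apply, ← NormalizedEigenform.eigenChar_smul, h,
    NormalizedEigenform.eigenChar_smul]

end NumberField

/-- Under Maeda's conjecture, automorphisms of `ℂ` realize all permutations of the eigenforms, and
the number of eigenforms is the dimension of the space of cusp forms. -/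
lemma MaedaConjecture.toPermHom_surjective (hk : MaedaConjecture k) (f₀ : NormalizedEigenform k) :
    Finite (NormalizedEigenform k) ∧
    Nat.card (NormalizedEigenform k) = Module.finrank ℂ (CuspForm 𝒮ℒ k) ∧
    Function.Surjective (MulAction.toPermHom (ℂ ≃+* ℂ) (NormalizedEigenform k)) := by
  obtain ⟨K, _, _, ⟨e⟩, ⟨r⟩⟩ := hk
  have hfin := NormalizedEigenform.finite e f₀
  have hcard := NormalizedEigenform.card_eq_finrank e f₀
  refine ⟨hfin, hcard, ?_⟩
  set L := IntermediateField.normalClosure ℚ K ℂ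
  have hlift : ∀ τ : L ≃ₐ[ℚ] L, ∃ σ : ℂ ≃+* ℂ, ∀ x : L, σ x = τ x := fun τ ↦
    exists_ringEquiv_comp_eq (F := L) (L.val : L →+* ℂ)
      ((L.val.comp τ.toAlgHom : L →ₐ[ℚ] ℂ) : L →+* ℂ)
  choose s hs using hlift
  let P : (L ≃ₐ[ℚ] L) → Equiv.Perm (NormalizedEigenform k) :=
    fun τ ↦ MulAction.toPermHom _ _ (s τ)
  have hP : Function.Injective P := by
    intro τ τ' h
    ext x
    rw [← hs, ← hs]
    exact eq_on_normalClosure e f₀ (fun f ↦ DFunLike.congr_fun h f) x.2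
  -- Both sides have `n!` elements, so injectivity suffices; the lifts `s τ` need not be
  -- multiplicative.
  have hP' : Function.Bijective P := by
    refine (Nat.bijective_iff_injective_and_card P).mpr ⟨hP, ?_⟩
    rw [Nat.card_congr r.toEquiv, Nat.card_perm, Nat.card_perm, hcard, Nat.card_fin]
  intro π
  obtain ⟨τ, rfl⟩ := hP'.surjective π
  exact ⟨s τ, rfl⟩

/-! ### Products of cusp forms -/

/-- The product of two cusp forms of weight `k`. -/
def cuspMul (f : CuspForm 𝒮ℒ k) : CuspForm 𝒮ℒ k →ₗ[ℂ] CuspForm 𝒮ℒ (2 * k) where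
  toFun g := CuspForm.mcast (two_mul k).symm (f.mulModularForm (g : ModularForm 𝒮ℒ k))
  map_add' g h := CuspForm.ext fun z ↦ mul_add (f z) (g z) (h z)
  map_smul' c g := CuspForm.ext fun z ↦ mul_left_comm (f z) c (g z)

lemma cuspMul_apply (f g : CuspForm 𝒮ℒ k) (z : ℍ) : cuspMul f g z = f z * g z := rfl

lemma qExpansion_cuspMul (f g : CuspForm 𝒮ℒ k) :
    qExpansion 1 (cuspMul f g) = qExpansion 1 f * qExpansion 1 g :=
  ModularForm.qExpansion_mul_coe one_pos one_mem_strictPeriods_SL f g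

lemma qExpansion_ne_zero {f : CuspForm 𝒮ℒ k} (hf : f ≠ 0) : qExpansion 1 f ≠ 0 := fun h ↦
  hf (cuspForm_ext_qExpansion (h.trans (qExpansion_zero 1).symm))

lemma cuspMul_ne_zero {f g : CuspForm 𝒮ℒ k} (hf : f ≠ 0) (hg : g ≠ 0) : cuspMul f g ≠ 0 := by
  intro h
  have h1 := qExpansion_cuspMul f g
  rw [h] at h1
  exact mul_ne_zero (qExpansion_ne_zero hf) (qExpansion_ne_zero hg)
    (h1.symm.trans (qExpansion_zero 1))

lemma fourierCoeff_two_cuspMul (f g : CuspForm 𝒮ℒ k) :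
    fourierCoeff 2 (cuspMul f g) = fourierCoeff 1 f * fourierCoeff 1 g := by
  change (qExpansion 1 (cuspMul f g)).coeff 2 = _
  have hf := fourierCoeff_zero f
  have hg := fourierCoeff_zero g
  change (qExpansion 1 f).coeff 0 = 0 at hf
  change (qExpansion 1 g).coeff 0 = 0 at hg
  rw [qExpansion_cuspMul, PowerSeries.coeff_mul]
  simp [Finset.Nat.antidiagonal_succ, hf, hg]
  rfl

/-- If there are two eigenforms in weight `k`, then there are more cusp forms in weight `2 * k` than
in weight `k`. -/
lemma finrank_lt_of_ne {f₁ f₂ : NormalizedEigenform k} (h : f₁ ≠ f₂) :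
    Module.finrank ℂ (CuspForm 𝒮ℒ k) < Module.finrank ℂ (CuspForm 𝒮ℒ (2 * k)) := by
  have hne : f₁.1 - f₂.1 ≠ 0 := fun h' ↦ h (Subtype.ext (sub_eq_zero.mp h'))
  have hinj : Function.Injective (cuspMul (f₁.1 - f₂.1)) := by
    rw [← LinearMap.ker_eq_bot, LinearMap.ker_eq_bot']
    intro g hg
    by_contra hg0
    exact cuspMul_ne_zero hne hg0 hg
  refine lt_of_le_of_ne (LinearMap.finrank_le_finrank_of_injective hinj) fun heq ↦ ?_
  obtain ⟨w, hw⟩ := (LinearMap.injective_iff_surjective_of_finrank_eq_finrank heq).mp hinj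
    (cuspMul f₁.1 f₁.1)
  -- Cusp forms start at `q`, so products start at `q²`. There `(f₁ - f₂) w` has coefficient `0`,
  -- while `f₁²` has coefficient `1`.
  have h2 := congrArg (fourierCoeff 2) hw
  rw [fourierCoeff_two_cuspMul, fourierCoeff_two_cuspMul, map_sub, f₁.fourierCoeff_one,
    f₂.fourierCoeff_one] at h2
  simp at h2

lemma fourierCoeff_cuspMul_map (σ : ℂ ≃+* ℂ) {f : CuspForm 𝒮ℒ k}
    (h : ∀ n, σ (fourierCoeff n f) = fourierCoeff n f) (n : ℕ) :
    σ (fourierCoeff n (cuspMul f f)) = fourierCoeff n (cuspMul f f) := by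
  change σ ((qExpansion 1 (cuspMul f f)).coeff n) = (qExpansion 1 (cuspMul f f)).coeff n
  rw [qExpansion_cuspMul, PowerSeries.coeff_mul, map_sum]
  refine Finset.sum_congr rfl fun x _ ↦ ?_
  rw [map_mul]
  exact congrArg₂ _ (h _) (h _)

/-! ### Orthogonality of eigenforms -/

lemma peterssonInner_smul_left (c : ℂ) (f g : ℍ → ℂ) :
    peterssonInner k (c • f) g = (starRingEnd ℂ) c * peterssonInner k f g := by
  rw [peterssonInner, peterssonInner, ← MeasureTheory.integral_const_mul]
  simp only [petersson, Pi.smul_apply, smul_eq_mul, map_mul, mul_assoc]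

lemma peterssonInner_smul_right (c : ℂ) (f g : ℍ → ℂ) :
    peterssonInner k f (c • g) = c * peterssonInner k f g := by
  rw [peterssonInner_symm, peterssonInner_smul_left, map_mul, Complex.conj_conj,
    ← peterssonInner_symm]

lemma peterssonInner_sum_left {ι : Type*} (s : Finset ι) (F : ι → CuspForm 𝒮ℒ k)
    (g : CuspForm 𝒮ℒ k) : peterssonInner k (∑ i ∈ s, ⇑(F i)) g =
      ∑ i ∈ s, peterssonInner k (F i) g := by
  simp_rw [peterssonInner]
  rw [← MeasureTheory.integral_finsetSum _ fun i _ ↦ (F i).integrableOn_petersson g]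
  simp_rw [petersson_sum_left]

/-- Distinct normalized eigenforms are orthogonal. -/
lemma NormalizedEigenform.peterssonInner_eq_zero {f g : NormalizedEigenform k} (h : f ≠ g) :
    peterssonInner k f.1 g.1 = 0 := by
  have key : ∀ (f g : NormalizedEigenform k) (m : ℕ+),
      (starRingEnd ℂ) (fourierCoeff m f.1) * peterssonInner k f.1 g.1 =
        fourierCoeff m g.1 * peterssonInner k f.1 g.1 := by
    intro f g m
    have := peterssonInner_heckeOperator_comm m f.1 g.1
    rwa [f.heckeOperator_apply, g.heckeOperator_apply, FunLike.coe_smul, FunLike.coe_smul,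
      peterssonInner_smul_left, peterssonInner_smul_right] at this
  by_contra h0
  refine h (Subtype.ext (ext_fourierCoeff fun m ↦ ?_))
  -- Pairing `f` with itself shows that its eigenvalues are real.
  have h1 := mul_right_cancel₀ (peterssonInner_self_ne_zero f.ne_zero) (key f f m)
  have h2 := mul_right_cancel₀ h0 (key f g m)
  exact h1.symm.trans h2

lemma NormalizedEigenform.peterssonInner_sum [Fintype (NormalizedEigenform k)]
    (c : NormalizedEigenform k → ℂ) (g : NormalizedEigenform k) :
    peterssonInner k (∑ j, c j • j.1 : CuspForm 𝒮ℒ k) g.1 =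
      (starRingEnd ℂ) (c g) * peterssonInner k g.1 g.1 := by
  have h : ⇑(∑ j, c j • j.1 : CuspForm 𝒮ℒ k) = ∑ j, ⇑(c j • j.1) :=
    map_sum (FunLike.coeAddMonoidHom (CuspForm 𝒮ℒ k) ℍ ℂ) _ _
  rw [h, peterssonInner_sum_left, Finset.sum_eq_single g]
  · rw [FunLike.coe_smul, peterssonInner_smul_left]
  · intro j _ hj
    rw [FunLike.coe_smul, peterssonInner_smul_left, peterssonInner_eq_zero hj, mul_zero]
  · simp

/-- Under Maeda's conjecture in weights `k` and `2 * k`, the square of an eigenform of weight `k` is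
not orthogonal to any eigenform of weight `2 * k`. -/
theorem peterssonInner_sq_ne_zero (hk : MaedaConjecture k) (h2k : MaedaConjecture (2 * k))
    {f : CuspForm 𝒮ℒ k} {g : CuspForm 𝒮ℒ (2 * k)} (hf0 : f ≠ 0) (hg0 : g ≠ 0)
    (hf : IsHeckeEigenform f) (hg : IsHeckeEigenform g) :
    peterssonInner (2 * k) (fun z ↦ f z ^ 2) g ≠ 0 := by
  obtain ⟨f, a, ha, rfl⟩ := hf.exists_eq_smul hf0
  obtain ⟨g, b, hb, rfl⟩ := hg.exists_eq_smul hg0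
  obtain ⟨hX, hXcard, -⟩ := hk.toPermHom_surjective f
  obtain ⟨hY, hYcard, hYperm⟩ := h2k.toPermHom_surjective g
  have := Fintype.ofFinite (NormalizedEigenform (2 * k))
  have hXpos : 0 < Nat.card (NormalizedEigenform k) := @Nat.card_pos _ ⟨f⟩ _
  have hXY : (Nat.card (NormalizedEigenform k)).factorial <
      (Nat.card (NormalizedEigenform (2 * k))).factorial ∨
      Subsingleton (NormalizedEigenform (2 * k)) := by
    by_cases hY1 : Subsingleton (NormalizedEigenform (2 * k))
    · exact .inr hY1
    left
    -- Positivity is required because `0! = 1!`; the form `f` itself provides it.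
    refine (Nat.factorial_lt hXpos).mpr ?_
    by_cases hX1 : Subsingleton (NormalizedEigenform k)
    · rw [not_subsingleton_iff_nontrivial] at hY1
      exact Finite.card_le_one_iff_subsingleton.mpr hX1 |>.trans_lt Finite.one_lt_card
    · rw [not_subsingleton_iff_nontrivial] at hX1
      obtain ⟨f₁, f₂, hne⟩ := hX1.exists_pair_ne
      rw [hXcard, hYcard]
      exact finrank_lt_of_ne hne
  have hspan := NormalizedEigenform.linearIndependent.span_eq_top_of_card_eq_finrank'
    (Nat.card_eq_fintype_card.symm.trans hYcard)
  obtain ⟨c, hc⟩ := (Submodule.mem_span_range_iff_exists_fun ℂ).mp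
    (hspan ▸ Submodule.mem_top : cuspMul f.1 f.1 ∈ _)
  have hcg : c g ≠ 0 := by
    intro hcg
    have hzero : ∀ j, c j = 0 := by
      intro j
      obtain ⟨σ, hσ, rfl⟩ := exists_smul_eq_of_smul_eq_self (X := NormalizedEigenform k)
        hYperm hXY g j
      have hσf : ∀ n, σ (fourierCoeff n f.1) = fourierCoeff n f.1 := fun n ↦ by
        rw [← NormalizedEigenform.fourierCoeff_smul, hσ]
      -- Both sides equal `f²`: the left by reindexing, the right by applying `σ` to its
      -- coefficients. Independence then gives `c (σ • g) = σ (c g) = 0`.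
      have h1 : ∑ j, c (σ • j) • (σ • j).1 = ∑ j, σ (c j) • (σ • j).1 := by
        refine Eq.trans (Fintype.sum_bijective (fun j ↦ σ • j) (MulAction.bijective σ) _
          (fun j ↦ c j • j.1) fun _ ↦ rfl) (hc.trans (ext_fourierCoeff fun m ↦ ?_))
        rw [← fourierCoeff_cuspMul_map σ hσf, ← hc, map_sum, map_sum, map_sum]
        refine Finset.sum_congr rfl fun j _ ↦ ?_
        rw [LinearMap.map_smul, LinearMap.map_smul, NormalizedEigenform.fourierCoeff_smul,
          smul_eq_mul, smul_eq_mul, map_mul]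
      have h2 := NormalizedEigenform.linearIndependent.comp
        (fun j : NormalizedEigenform (2 * k) ↦ σ • j) (MulAction.injective σ)
      rw [Fintype.linearIndependent_iff] at h2
      have h3 := h2 (fun j ↦ c (σ • j) - σ (c j)) (by
        simp only [sub_smul, Finset.sum_sub_distrib, Function.comp_apply]
        exact sub_eq_zero.mpr h1) g
      rw [hcg, map_zero, sub_zero] at h3
      exact h3
    refine cuspMul_ne_zero f.ne_zero f.ne_zero (hc.symm.trans ?_)
    exact Finset.sum_eq_zero fun j _ ↦ by rw [hzero, zero_smul]
  have hsq : (fun z ↦ (a • f.1) z ^ 2) = a ^ 2 • ⇑(∑ j, c j • j.1 : CuspForm 𝒮ℒ (2 * k)) := by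
    rw [hc]
    ext z
    rw [Pi.smul_apply, cuspMul_apply, FunLike.coe_smul, Pi.smul_apply, smul_eq_mul, smul_eq_mul]
    ring
  rw [hsq, FunLike.coe_smul, peterssonInner_smul_left, peterssonInner_smul_right,
    NormalizedEigenform.peterssonInner_sum]
  refine mul_ne_zero ?_ (mul_ne_zero hb (mul_ne_zero ?_ (peterssonInner_self_ne_zero g.ne_zero)))
  · exact (map_ne_zero _).mpr (pow_ne_zero _ ha)
  · exact (map_ne_zero _).mpr hcg

end

end Maeda

theorem theorem3 (k : ℤ) (hk : Maeda.MaedaConjecture k) (h2k : Maeda.MaedaConjecture (2 * k))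
    (f : CuspForm 𝒮ℒ k) (g : CuspForm 𝒮ℒ (2 * k)) (hf0 : f ≠ 0) (hg0 : g ≠ 0)
    (hf : Maeda.IsHeckeEigenform f) (hg : Maeda.IsHeckeEigenform g) :
    Maeda.peterssonInner (2 * k) (fun z ↦ f z ^ 2) g ≠ 0 :=
  Maeda.peterssonInner_sq_ne_zero hk h2k hf0 hg0 hf hg
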